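/- Let $X,Y$ be finite non-empty input sets with $|X\times Y|\le 2^n$, let $\mathcal A,\mathcal B$ be finite output sets, $A=|\mathcal A|$, $B=|\mathcal B|$. A conditional distribution $p(a,b|x,y)$ on $\mathcal A\times\mathcal B$ is non-signaling if its marginal on $a$ does not depend on $y$ and its marginal on $b$ does not depend on $x$. It is local if it is a convex combination of the deterministic distributions $\mathbf 1[a=f(x)]\,\mathbf 1[b=g(y)]$ with $f:X\to\mathcal A$, $g:Y\to\mathcal B$. For non-signaling $p$ put $$\tilde\nu(p)=\min\Big\{\sum_i|q_i| : p=\sum_i q_ip_i,\ p_i \text{ local},\ q_i\in\mathbb R\Big\},\qquad \tilde\nu^{\epsilon}(p)=\min\{\tilde\nu(p') : p' \text{ non-signaling},\ \delta(p,p')\le\epsilon\},$$ where $\delta(p,p')=\max_{x,y,\mathcal E\subseteq\mathcal A\times\mathcal B}|p(\mathcal E|x,y)-p'(\mathcal E|x,y)|$ is the total variation distance. In the simultaneous-message model Alice (who knows $x$) and Bob (who knows $y$) each send one message to a referee, who knows neither input and outputs a pair $(a,b)\in\mathcal A\times\mathcal B$. Let $R^{\parallel,\mathrm{pub}}_{\epsilon}(p)$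 be the least total number of bits sent in a classical protocol of this kind in which Alice and Bob share randomness and whose output distribution $p'$ satisfies $\delta(p,p')\le\epsilon$. Let $Q^{\parallel}_{\epsilon}(p)$ be the least total number of qubits sent in a protocol of this kind with quantum messages, without shared randomness or entanglement (the referee performs a measurement on the product of the two message states), with the same requirement on the output distribution. **Theorem.** For every non-signaling $p$ as above and all $0\le\epsilon<\tfrac12$, $0<\delta<\tfrac12$, 1. $\displaystyle R^{\parallel,\mathrm{pub}}_{\epsilon+\delta}(p)\le 16\left[\frac{AB\,\tilde\nu^{\epsilon}(p)}{\delta}\right]^2\ln\left[\frac{4AB}{\delta}\right]\log_2(AB)$; 2. if $n\ge2$, then $\displaystyle Q^{\parallel}_{\epsilon+\delta}(p)\le K\,(AB)^5\left[\frac{\tilde\nu^{\epsilon}(p)}{\delta}\right]^4\ln\left[\frac{AB}{\delta}\right]\log_2 n$, where $K>0$ is an absolute constant. -/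

import Mathlib

open scoped ComplexOrder Kronecker

namespace SMP

section Behaviors

variable {X Y A B : Type*}

/-- A table of numbers `p x y (a, b)`, standing for `p(a, b | x, y)`. -/
abbrev Behavior (X Y A B : Type*) : Type _ := X → Y → A × B → ℝ

/-- `p` is a non-signaling (conditional) distribution: every `p(·,· | x, y)` is a probability
distribution on `A × B`, Alice's marginal does not depend on `y`, and Bob's marginal does not
depend on `x`. -/
structure IsNonSignaling [Fintype A] [Fintype B] (p : Behavior X Y A B) : Prop where
  isDistribution : ∀ x y, p x y ∈ stdSimplex ℝ (A × B)
  alice_marginal : ∀ a x y y', ∑ b, p x y (a, b) = ∑ b, p x y' (a, b)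
  bob_marginal : ∀ b x x' y, ∑ a, p x y (a, b) = ∑ a, p x' y (a, b)

open Classical in
/-- The local deterministic distribution in which Alice answers `f x` and Bob answers `g y`. -/
noncomputable def localDeterministic (f : X → A) (g : Y → B) : Behavior X Y A B :=
  fun x y ab => if ab = (f x, g y) then 1 else 0

/-- The local distributions: convex combinations of local deterministic ones. -/
def localSet (X Y A B : Type*) : Set (Behavior X Y A B) :=
  convexHull ℝ {p | ∃ (f : X → A) (g : Y → B), p = localDeterministic f g}

/-- `ν̃(p) = min {∑ |qᵢ| : p = ∑ qᵢ pᵢ, pᵢ local, qᵢ real}`. -/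
noncomputable def nuTilde (p : Behavior X Y A B) : ℝ :=
  sInf {s | ∃ (k : ℕ) (q : Fin k → ℝ) (P : Fin k → Behavior X Y A B),
    (∀ i, P i ∈ localSet X Y A B) ∧ p = ∑ i, q i • P i ∧ s = ∑ i, |q i|}

/-- Total variation distance
`δ(p, p') = max {|p(E | x, y) - p'(E | x, y)| : x ∈ X, y ∈ Y, E ⊆ A × B}`
(for finite `X`, `Y`, `A`, `B`). -/
noncomputable def tvDist (p p' : Behavior X Y A B) : ℝ :=
  ⨆ t : X × Y × Finset (A × B), |∑ ab ∈ t.2.2, p t.1 t.2.1 ab - ∑ ab ∈ t.2.2, p' t.1 t.2.1 ab|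

/-- `ν̃^ε(p) = min {ν̃(p') : δ(p, p') ≤ ε}`, where `p'` ranges over the non-signaling
distributions (those which have an affine model, that is, for which `ν̃(p')` exists). -/
noncomputable def nuTildeApprox [Fintype A] [Fintype B] (ε : ℝ) (p : Behavior X Y A B) : ℝ :=
  sInf {s | ∃ p' : Behavior X Y A B, IsNonSignaling p' ∧ tvDist p p' ≤ ε ∧ s = nuTilde p'}

end Behaviors

/-- Strings of `k` bits; also the index set of the computational basis of `k` qubits. -/
abbrev BitString (k : ℕ) : Type := Fin k → Bool

/-- A classical simultaneous-message protocol with shared randomness. Alice and Bob share a random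
element `r` of a finite probability space `(Fin m, μ)`. On input `x`, Alice sends to the referee a
random `kA`-bit message with law `alice r x`, on input `y` Bob sends a random `kB`-bit message with
law `bob r y` (independent private coins), and on receiving `s` and `t` the referee, who sees
neither the inputs nor `r`, outputs a pair in `A × B` with law `referee s t`. -/
structure PublicCoinProtocol (X Y A B : Type*) [Fintype A] [Fintype B] (kA kB : ℕ) where
  m : ℕ
  μ : Fin m → ℝ
  μ_mem : μ ∈ stdSimplex ℝ (Fin m)
  alice : Fin m → X → BitString kA → ℝ
  alice_mem : ∀ r x, alice r x ∈ stdSimplex ℝ (BitString kA)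
  bob : Fin m → Y → BitString kB → ℝ
  bob_mem : ∀ r y, bob r y ∈ stdSimplex ℝ (BitString kB)
  referee : BitString kA → BitString kB → A × B → ℝ
  referee_mem : ∀ s t, referee s t ∈ stdSimplex ℝ (A × B)

/-- A quantum simultaneous-message protocol without shared resources. On input `x`, Alice sends to
the referee `kA` qubits in the (possibly mixed) state `alice x`, on input `y` Bob sends `kB` qubits
in the state `bob y`, and the referee measures the product state `alice x ⊗ bob y` with a POVM with
outcomes in `A × B`. -/
structure QuantumProtocol (X Y A B : Type*) [Fintype A] [Fintype B] (kA kB : ℕ) where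
  alice : X → Matrix (BitString kA) (BitString kA) ℂ
  alice_posSemidef : ∀ x, (alice x).PosSemidef
  alice_trace : ∀ x, (alice x).trace = 1
  bob : Y → Matrix (BitString kB) (BitString kB) ℂ
  bob_posSemidef : ∀ y, (bob y).PosSemidef
  bob_trace : ∀ y, (bob y).trace = 1
  povm : A × B → Matrix (BitString kA × BitString kB) (BitString kA × BitString kB) ℂ
  povm_posSemidef : ∀ ab, (povm ab).PosSemidef
  povm_sum : ∑ ab, povm ab = 1

section Complexity

variable {X Y A B : Type*} [Fintype A] [Fintype B]

/-- The conditional distribution produced by a classical protocol. -/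
def PublicCoinProtocol.output {kA kB : ℕ} (π : PublicCoinProtocol X Y A B kA kB) :
    Behavior X Y A B :=
  fun x y ab => ∑ r, π.μ r * ∑ s, ∑ t, π.alice r x s * π.bob r y t * π.referee s t ab

/-- The conditional distribution produced by a quantum protocol (Born rule; the trace below is a
nonnegative real number). -/
def QuantumProtocol.output {kA kB : ℕ} (π : QuantumProtocol X Y A B kA kB) :
    Behavior X Y A B :=
  fun x y ab => (π.povm ab * (π.alice x ⊗ₖ π.bob y)).trace.re

/-- The numbers `c` such that some public-coin simultaneous-message protocol with `c` bits of
communication simulates `p` up to error `ε`. -/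
def publicCoinCosts (ε : ℝ) (p : Behavior X Y A B) : Set ℕ :=
  {c | ∃ (kA kB : ℕ) (π : PublicCoinProtocol X Y A B kA kB),
    tvDist p π.output ≤ ε ∧ c = kA + kB}

/-- The numbers `c` such that some quantum simultaneous-message protocol with `c` qubits of
communication simulates `p` up to error `ε`. -/
def quantumCosts (ε : ℝ) (p : Behavior X Y A B) : Set ℕ :=
  {c | ∃ (kA kB : ℕ) (π : QuantumProtocol X Y A B kA kB),
    tvDist p π.output ≤ ε ∧ c = kA + kB}

/-- `R_ε^{∥,pub}(p)`. -/
noncomputable def publicCoinComplexity (ε : ℝ) (p : Behavior X Y A B) : ℕ :=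
  sInf (publicCoinCosts ε p)

/-- `Q_ε^∥(p)`. -/
noncomputable def quantumComplexity (ε : ℝ) (p : Behavior X Y A B) : ℕ :=
  sInf (quantumCosts ε p)

end Complexity

theorem tvDist_self {X Y A B : Type*} (p : Behavior X Y A B) :
    tvDist p p = 0 := by
  simp [tvDist]

section WellDefined

variable {X Y A B : Type*} [Fintype A] [Fintype B]

/-- Any finite set embeds into bit strings, with a left inverse if it is nonempty. -/
theorem exists_encoding (X : Type*) [Finite X] [Nonempty X] :
    ∃ (k : ℕ) (e : X → BitString k) (d : BitString k → X), ∀ x, d (e x) = x := by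
  obtain ⟨k, ⟨f⟩⟩ := Finite.exists_equiv_fin X
  classical
  let e : X → BitString k := fun x i => decide (i = f x)
  have he : Function.Injective e := by
    intro x x' h
    have h1 := congrFun h (f x)
    simp only [e, decide_true] at h1
    exact f.injective (of_decide_eq_true h1.symm)
  exact ⟨k, e, Function.invFun e, Function.leftInverse_invFun he⟩

/-- If the players send their inputs, the referee can simulate `p` exactly, so the minimum that
defines `R_ε^{∥,pub}(p)` exists. -/
theorem publicCoinCosts_nonempty [Finite X] [Finite Y] [Nonempty X] [Nonempty Y] {ε : ℝ}
    (hε : 0 ≤ ε) {p : Behavior X Y A B} (hp : ∀ x y, p x y ∈ stdSimplex ℝ (A × B)) :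
    (publicCoinCosts ε p).Nonempty := by
  obtain ⟨k, e, d, hd⟩ := exists_encoding X
  obtain ⟨l, e', d', hd'⟩ := exists_encoding Y
  let π : PublicCoinProtocol X Y A B k l :=
    { m := 1
      μ := fun _ => 1
      μ_mem := by simp [stdSimplex]
      alice := fun _ x => Pi.single (e x) 1
      alice_mem := fun _ x => single_mem_stdSimplex ℝ (e x)
      bob := fun _ y => Pi.single (e' y) 1
      bob_mem := fun _ y => single_mem_stdSimplex ℝ (e' y)
      referee := fun s t => p (d s) (d' t)
      referee_mem := fun s t => hp _ _ }
  have h : π.output = p := by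
    funext x y ab
    simp [PublicCoinProtocol.output, π, Pi.single_apply, hd, hd']
  exact ⟨k + l, k, l, π, by rw [h, tvDist_self]; exact hε, rfl⟩

/-- If the players send their inputs, the referee can simulate `p` exactly, so the minimum that
defines `Q_ε^∥(p)` exists. -/
theorem quantumCosts_nonempty [Finite X] [Finite Y] [Nonempty X] [Nonempty Y] {ε : ℝ}
    (hε : 0 ≤ ε) {p : Behavior X Y A B} (hp : ∀ x y, p x y ∈ stdSimplex ℝ (A × B)) :
    (quantumCosts ε p).Nonempty := by
  obtain ⟨k, e, d, hd⟩ := exists_encoding X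
  obtain ⟨l, e', d', hd'⟩ := exists_encoding Y
  let π : QuantumProtocol X Y A B k l :=
    { alice := fun x => Matrix.diagonal (Pi.single (e x) 1)
      alice_posSemidef := fun x => Matrix.PosSemidef.diagonal (by
        intro s; by_cases h : s = e x <;> simp [h])
      alice_trace := fun x => by simp [Matrix.trace_diagonal]
      bob := fun y => Matrix.diagonal (Pi.single (e' y) 1)
      bob_posSemidef := fun y => Matrix.PosSemidef.diagonal (by
        intro s; by_cases h : s = e' y <;> simp [h])
      bob_trace := fun y => by simp [Matrix.trace_diagonal]
      povm := fun ab => Matrix.diagonal (fun st => ((p (d st.1) (d' st.2) ab : ℝ) : ℂ))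
      povm_posSemidef := fun ab => Matrix.PosSemidef.diagonal (by
        intro st
        exact Complex.zero_le_real.mpr ((hp (d st.1) (d' st.2)).1 ab))
      povm_sum := by
        ext st st'
        by_cases h : st = st'
        · subst h
          have := (hp (d st.1) (d' st.2)).2
          simp only [Matrix.sum_apply, Matrix.diagonal_apply_eq, Matrix.one_apply_eq]
          exact_mod_cast this
        · simp [Matrix.sum_apply, Matrix.diagonal_apply_ne _ h, Matrix.one_apply_ne h] }
  have h : π.output = p := by
    funext x y ab
    simp [QuantumProtocol.output, π, Matrix.diagonal_kronecker_diagonal,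
      Matrix.diagonal_mul_diagonal, Matrix.trace_diagonal, Fintype.sum_prod_type,
      Pi.single_apply, hd, hd']
  exact ⟨k + l, k, l, π, by rw [h, tvDist_self]; exact hε, rfl⟩

end WellDefined

end SMP

/-! A non-signaling `p'` is a signed combination `∑ c • localDeterministic f g`; put `L = ∑ |c|` and
`N = AB`. Drawing `(f, g)` with probability `|c| / L` and recording `L · sign(c) · 1[(f x, g y) =
(a, b)]` gives an unbiased estimator of `p'(a, b | x, y)` with second moment at most `L²`. The
referee averages `T` such samples, replaces the resulting table by a nearest probability
distribution and samples from that. The error in total variation is of order `N L / √T`, so `T` of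
order `(N L / δ)²` suffices (`exists_postprocessing`). Only second moments are used; the logarithms
of `AB / δ` in both bounds merely absorb constants.

With shared randomness the players draw the same `(f, g)`; a sample costs the sign, Alice's answer
and Bob's answer (`exists_publicCoinProtocol`).

Without shared randomness, a Chernoff bound with a union bound over all `(x, y, a, b)` first
replaces the mixture by an average of `R` fixed pairs `(fᵢ, gᵢ)` with signs
(`exists_sparse_signed_model`). As `log |X × Y|` is of order `n`, it is enough that `R` is
polynomial in `n`, `N` and `L / δ`, so an index `i` fits in `O(log n)` qubits up to the other
parameters. Each player sends a superposition of a reference state and of all `|i, answer⟩`.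
Interference between "Alice reference, Bob `i`" and "Alice `i`, Bob reference" pairs equal indices,
and a measurement sees the signed average linearly, hence with its sign
(`exists_fingerprint_measurement`). Repetition on `T` copies and the same postprocessing finish the
argument. -/

namespace SMP

/-! ### Signed local models of non-signaling distributions -/

section AffineModel

open Finset

/-- A table whose rows have equal sums is a signed combination of deterministic tables. -/
theorem exists_signed_deterministic {X A E : Type*} [Fintype X] [Fintype A] [DecidableEq X]
    [DecidableEq A] [Nonempty X] [AddCommGroup E] (u : X → A → E)
    (h : ∀ x x', ∑ a, u x a = ∑ a, u x' a) :
    ∃ w : (X → A) → E, ∀ x a, u x a = ∑ f, if f x = a then w f else 0 := by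
  obtain ⟨x₀⟩ := ‹Nonempty X›
  rcases isEmpty_or_nonempty A with hA | ⟨⟨a₀⟩⟩
  · exact ⟨0, fun _ a => isEmptyElim a⟩
  set e := ∑ a, u x₀ a with he
  -- The value `u x a` is placed on the function equal to `a₀` except for the value `a` at `x`. At a
  -- point `x'`, each of the other `|X| - 1` rows contributes the common sum `e` to the answer `a₀`;
  -- the mass subtracted at the constant function cancels this.
  refine ⟨fun f => (∑ x, ∑ a, if f = Function.update (fun _ => a₀) x a then u x a else 0) -
    if f = (fun _ => a₀) then (Fintype.card X - 1) • e else 0, fun x' a' => ?_⟩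
  have h1 : ∀ f : X → A, (if f x' = a' then
      ((∑ x, ∑ a, if f = Function.update (fun _ => a₀) x a then u x a else 0) -
      if f = (fun _ => a₀) then (Fintype.card X - 1) • e else 0) else 0) =
      (∑ x, ∑ a, if f = Function.update (fun _ => a₀) x a then
        (if f x' = a' then u x a else 0) else 0) -
      if f = (fun _ => a₀) then (if f x' = a' then (Fintype.card X - 1) • e else 0) else 0 := by
    intro f
    by_cases hf : f x' = a' <;> simp [hf]
  simp_rw [h1, sum_sub_distrib]
  rw [sum_comm]
  simp_rw [sum_comm (s := (univ : Finset (X → A)))]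
  simp only [sum_ite_eq', mem_univ, if_true]
  rw [← add_sum_erase _ _ (mem_univ x')]
  simp only [Function.update_self, sum_ite_eq', mem_univ, if_true]
  have h2 : ∑ x ∈ univ.erase x', ∑ a, (if Function.update (fun _ : X => a₀) x a x' = a' then u x a
      else 0) = if a₀ = a' then (Fintype.card X - 1) • e else 0 := by
    have h3 : ∀ x ∈ univ.erase x', ∑ a, (if Function.update (fun _ : X => a₀) x a x' = a' then u x a
      else 0) = if a₀ = a' then e else 0 := by
      intro x hx
      have hne : x' ≠ x := (ne_of_mem_erase hx).symm
      simp only [Function.update_of_ne hne]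
      split_ifs
      · rw [he, h x x₀]
      · simp
    rw [sum_congr rfl h3, sum_const, card_erase_of_mem (mem_univ _), card_univ]
    split_ifs <;> simp
  rw [h2]
  simp

variable {X Y A B : Type*}

/-- The tables on `Y × B` whose sum over `B` does not depend on `y`. -/
def equalMarginals (Y B : Type*) [Fintype B] : AddSubgroup (Y → B → ℝ) where
  carrier := {v | ∀ y y', ∑ b, v y b = ∑ b, v y' b}
  zero_mem' := by simp
  add_mem' := by
    intro u v hu hv y y'
    simp [sum_add_distrib, hu y y', hv y y']
  neg_mem' := by
    intro u hu y y'
    simp [hu y y']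

theorem localDeterministic_apply [DecidableEq A] [DecidableEq B] (f : X → A) (g : Y → B) (x : X)
    (y : Y) (ab : A × B) :
    localDeterministic f g x y ab = if f x = ab.1 ∧ g y = ab.2 then 1 else 0 := by
  unfold localDeterministic
  congr 1
  simp only [Prod.ext_iff, eq_iff_iff]
  tauto

theorem sum_localDeterministic [Fintype A] [Fintype B] (f : X → A) (g : Y → B) (x : X) (y : Y) :
    ∑ ab, localDeterministic f g x y ab = 1 := by
  simp [localDeterministic]

/-- Every non-signaling distribution is a signed combination of local deterministic ones. -/
theorem IsNonSignaling.exists_signed_model [Fintype X] [Fintype Y] [Fintype A] [Fintype B]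
    [DecidableEq X] [DecidableEq Y]
    [Nonempty X] [Nonempty Y] {p : Behavior X Y A B} (hp : IsNonSignaling p) :
    ∃ c : (X → A) × (Y → B) → ℝ, p = ∑ fg, c fg • localDeterministic fg.1 fg.2 := by
  classical
  -- The decomposition is applied twice: to Alice's side with coefficients in the group of Bob's
  -- tables with equal row sums, then to each coefficient. Working in `equalMarginals` is what makes
  -- the second application possible.
  obtain ⟨w, hw⟩ := exists_signed_deterministic (E := equalMarginals Y B)
    (fun x a => ⟨fun y b => p x y (a, b), fun y y' => hp.alice_marginal a x y y'⟩) (by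
      intro x x'
      ext y b
      simpa using hp.bob_marginal b x x' y)
  choose c hc using fun f => exists_signed_deterministic (w f : Y → B → ℝ) (w f).2
  refine ⟨fun fg => c fg.1 fg.2, ?_⟩
  funext x y ⟨a, b⟩
  have h1 := congrArg (fun v : equalMarginals Y B => (v : Y → B → ℝ) y b) (hw x a)
  simp only [AddSubgroup.val_finsetSum, Finset.sum_apply] at h1
  rw [h1]
  simp only [Finset.sum_apply, Pi.smul_apply, localDeterministic_apply, Fintype.sum_prod_type, smul_eq_mul]
  refine sum_congr rfl fun f _ => ?_
  by_cases hf : f x = a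
  · simp [hf, hc f y b]
  · simp [hf]

theorem exists_convex_weights_of_mem_localSet [Fintype X] [Fintype Y] [Fintype A] [Fintype B]
    [DecidableEq X] [DecidableEq Y]
    {P : Behavior X Y A B} (hP : P ∈ localSet X Y A B) :
    ∃ c ∈ stdSimplex ℝ ((X → A) × (Y → B)), P = ∑ fg, c fg • localDeterministic fg.1 fg.2 := by
  classical
  let F : ((X → A) × (Y → B) → ℝ) →ₗ[ℝ] Behavior X Y A B :=
    ∑ fg, (LinearMap.proj fg).smulRight (localDeterministic fg.1 fg.2)
  have hF : ∀ c, F c = ∑ fg, c fg • localDeterministic fg.1 fg.2 := by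
    intro c; simp [F]
  have hsub : localSet X Y A B ⊆ F '' stdSimplex ℝ ((X → A) × (Y → B)) := by
    refine convexHull_min ?_ ((convex_stdSimplex ℝ _).linear_image F)
    rintro _ ⟨f, g, rfl⟩
    refine ⟨Pi.single (f, g) 1, single_mem_stdSimplex ℝ _, ?_⟩
    rw [hF, sum_eq_single (f, g)]
    · simp
    · intro b _ hb; simp [hb]
    · simp
  obtain ⟨c, hc, rfl⟩ := hsub hP
  exact ⟨c, hc, hF c⟩

theorem localDeterministic_mem_localSet (f : X → A) (g : Y → B) :
    localDeterministic f g ∈ localSet X Y A B :=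
  subset_convexHull ℝ _ ⟨f, g, rfl⟩

/-- Expanding each local `P i` into deterministic distributions does not increase the total weight,
by the triangle inequality. The strict bound by `s` avoids having to show that the infimum is
attained. -/
theorem exists_signed_model_lt [Fintype X] [Fintype Y] [Fintype A] [Fintype B]
    [DecidableEq X] [DecidableEq Y] [Nonempty X] [Nonempty Y] {p : Behavior X Y A B}
    (hp : IsNonSignaling p) {s : ℝ} (hs : nuTilde p < s) :
    ∃ c : (X → A) × (Y → B) → ℝ,
      p = ∑ fg, c fg • localDeterministic fg.1 fg.2 ∧ ∑ fg, |c fg| < s := by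
  obtain ⟨c₀, hc₀⟩ := hp.exists_signed_model
  have hne : {s | ∃ (k : ℕ) (q : Fin k → ℝ) (P : Fin k → Behavior X Y A B),
      (∀ i, P i ∈ localSet X Y A B) ∧ p = ∑ i, q i • P i ∧ s = ∑ i, |q i|}.Nonempty := by
    let e := (Fintype.equivFin ((X → A) × (Y → B))).symm
    refine ⟨_, _, fun i => c₀ (e i), fun i => localDeterministic (e i).1 (e i).2,
      fun i => localDeterministic_mem_localSet _ _, ?_, rfl⟩
    rw [hc₀, ← e.sum_comp]
  obtain ⟨_, ⟨k, q, P, hP, rfl, rfl⟩, hlt⟩ := exists_lt_of_csInf_lt hne hs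
  choose c hc hPc using fun i => exists_convex_weights_of_mem_localSet (hP i)
  refine ⟨fun fg => ∑ i, q i * c i fg, ?_, lt_of_le_of_lt ?_ hlt⟩
  · simp_rw [sum_smul]
    rw [sum_comm]
    refine sum_congr rfl fun i _ => ?_
    rw [hPc i, smul_sum]
    simp_rw [smul_smul]
  · calc ∑ fg, |∑ i, q i * c i fg| ≤ ∑ fg, ∑ i, |q i| * c i fg := by
          refine sum_le_sum fun fg _ => (abs_sum_le_sum_abs _ _).trans (le_of_eq ?_)
          refine sum_congr rfl fun i _ => ?_
          rw [abs_mul, abs_of_nonneg ((hc i).1 fg)]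
      _ = ∑ i, |q i| := by
          rw [sum_comm]
          refine sum_congr rfl fun i _ => ?_
          rw [← mul_sum, (hc i).2, mul_one]

theorem exists_approx_signed_model [Fintype X] [Fintype Y] [Fintype A] [Fintype B]
    [DecidableEq X] [DecidableEq Y] [Nonempty X] [Nonempty Y] {p : Behavior X Y A B}
    (hp : IsNonSignaling p) {ε s : ℝ} (hε : 0 ≤ ε) (hs : nuTildeApprox ε p < s) :
    ∃ p' : Behavior X Y A B, IsNonSignaling p' ∧ tvDist p p' ≤ ε ∧
      ∃ c : (X → A) × (Y → B) → ℝ,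
        p' = ∑ fg, c fg • localDeterministic fg.1 fg.2 ∧ ∑ fg, |c fg| < s := by
  have hne : {s | ∃ p' : Behavior X Y A B, IsNonSignaling p' ∧ tvDist p p' ≤ ε ∧
      s = nuTilde p'}.Nonempty := ⟨_, p, hp, by rw [tvDist_self]; exact hε, rfl⟩
  obtain ⟨_, ⟨p', hp', hd, rfl⟩, hlt⟩ := exists_lt_of_csInf_lt hne hs
  exact ⟨p', hp', hd, exists_signed_model_lt hp' hlt⟩

theorem one_le_sum_abs_of_signed_model [Fintype X] [Fintype Y] [Fintype A] [Fintype B]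
    [DecidableEq X] [DecidableEq Y] [Nonempty X] [Nonempty Y] {p : Behavior X Y A B}
    (hp : IsNonSignaling p) {c : (X → A) × (Y → B) → ℝ}
    (hc : p = ∑ fg, c fg • localDeterministic fg.1 fg.2) : 1 ≤ ∑ fg, |c fg| := by
  obtain ⟨x⟩ := ‹Nonempty X›
  obtain ⟨y⟩ := ‹Nonempty Y›
  have h := (hp.isDistribution x y).2
  rw [hc] at h
  simp only [Finset.sum_apply, Pi.smul_apply, smul_eq_mul] at h
  rw [sum_comm] at h
  simp_rw [← mul_sum, sum_localDeterministic, mul_one] at h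
  rw [← h]
  exact sum_le_sum fun i _ => le_abs_self _

end AffineModel

/-! ### Total variation distance -/

section TotalVariation

variable {X Y A B : Type*}

theorem abs_sum_sub_sum_le_tvDist [Finite X] [Finite Y] [Finite A] [Finite B]
    (p p' : Behavior X Y A B) (x : X) (y : Y) (E : Finset (A × B)) :
    |∑ ab ∈ E, p x y ab - ∑ ab ∈ E, p' x y ab| ≤ tvDist p p' := by
  have := Fintype.ofFinite A
  have := Fintype.ofFinite B
  exact le_ciSup (f := fun t : X × Y × Finset (A × B) =>
    |∑ ab ∈ t.2.2, p t.1 t.2.1 ab - ∑ ab ∈ t.2.2, p' t.1 t.2.1 ab|)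
    (Set.finite_range _).bddAbove (x, y, E)

theorem tvDist_le_add [Finite X] [Finite Y] [Finite A] [Finite B] [Nonempty X] [Nonempty Y]
    {p p' p'' : Behavior X Y A B} {ε δ : ℝ} (h : tvDist p p' ≤ ε)
    (h' : ∀ x y (E : Finset (A × B)), |∑ ab ∈ E, p' x y ab - ∑ ab ∈ E, p'' x y ab| ≤ δ) :
    tvDist p p'' ≤ ε + δ := by
  refine ciSup_le fun ⟨x, y, E⟩ => ?_
  exact (abs_sub_le _ (∑ ab ∈ E, p' x y ab) _).trans
    (add_le_add ((abs_sum_sub_sum_le_tvDist p p' x y E).trans h) (h' x y E))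

end TotalVariation

/-! ### Empirical averages, second moments and derandomization -/

section Sampling

open Finset

variable {O C : Type*}

theorem sum_fin_succ_fun {O M : Type*} [Fintype O] [AddCommMonoid M] {T : ℕ}
    (F : (Fin (T + 1) → O) → M) : ∑ o, F o = ∑ a, ∑ o, F (Fin.cons a o) := by
  rw [← (Fin.consEquiv (fun _ => O)).sum_comp, Fintype.sum_prod_type]
  rfl

theorem sum_fun_prod {T : ℕ} {R : Type*} [CommSemiring R] [Fintype O] (f : Fin T → O → R) :
    ∑ o : Fin T → O, ∏ t, f t (o t) = ∏ t, ∑ a, f t a := by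
  rw [prod_univ_sum, Fintype.piFinset_univ]

theorem prod_mem_stdSimplex [Fintype O] {l : O → ℝ} (hl : l ∈ stdSimplex ℝ O) (T : ℕ) :
    (fun o : Fin T → O => ∏ t, l (o t)) ∈ stdSimplex ℝ (Fin T → O) :=
  ⟨fun o => prod_nonneg fun t _ => hl.1 (o t), by
    rw [sum_fun_prod (fun _ => l)]; simp [hl.2]⟩

/-- The variance of a sum of independent centered samples is the sum of the variances. -/
theorem sum_prod_mul_sq_sum [Fintype O] {l : O → ℝ} (hl : l ∈ stdSimplex ℝ O) {g : O → ℝ}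
    (hg : ∑ a, l a * g a = 0) (T : ℕ) :
    ∑ o : Fin T → O, (∏ t, l (o t)) * (∑ t, g (o t)) ^ 2 = T * ∑ a, l a * g a ^ 2 := by
  induction T with
  | zero => simp
  | succ T ih =>
    rw [sum_fin_succ_fun]
    simp only [Fin.prod_univ_succ, Fin.sum_univ_succ, Fin.cons_zero, Fin.cons_succ]
    have h1 : ∀ a, ∑ o : Fin T → O, l a * (∏ t, l (o t)) * (g a + ∑ t, g (o t)) ^ 2 =
        l a * g a ^ 2 + l a * g a * (2 * ∑ o : Fin T → O, (∏ t, l (o t)) * ∑ t, g (o t)) +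
          l a * ∑ o : Fin T → O, (∏ t, l (o t)) * (∑ t, g (o t)) ^ 2 := by
      intro a
      have h2 : l a * g a ^ 2 = l a * g a ^ 2 * ∑ o : Fin T → O, (∏ t, l (o t)) := by
        rw [(prod_mem_stdSimplex hl T).2, mul_one]
      rw [h2]
      simp only [mul_sum, ← sum_add_distrib]
      refine sum_congr rfl fun o _ => ?_
      simp only [← mul_sum]
      ring
    simp_rw [h1, sum_add_distrib, ← sum_mul, hg, hl.2, ih]
    push_cast
    ring

theorem sum_prod_mul_abs_avg_sub_le [Fintype O] {l : O → ℝ} (hl : l ∈ stdSimplex ℝ O)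
    (h : O → ℝ) {S c : ℝ} {T : ℕ} (hS : ∑ a, l a * h a ^ 2 ≤ S) (hc : 0 < c)
    (hT : S ≤ T * c ^ 2) :
    ∑ o : Fin T → O, (∏ t, l (o t)) * |(∑ t, h (o t)) / T - ∑ a, l a * h a| ≤ c := by
  set m := ∑ a, l a * h a with hm
  -- For `T = 0` the empty average is `0 / 0 = 0`, and the hypotheses force the second moment, hence
  -- the mean, to vanish.
  rcases Nat.eq_zero_or_pos T with rfl | hT0
  · have hS0 : ∑ a, l a * h a ^ 2 = 0 :=
      le_antisymm (hS.trans (by simpa using hT))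
        (sum_nonneg fun a _ => mul_nonneg (hl.1 a) (sq_nonneg _))
    have h0 := (sum_eq_zero_iff_of_nonneg
      (fun a _ => mul_nonneg (hl.1 a) (sq_nonneg (h a)))).1 hS0
    have hm0 : m = 0 := sum_eq_zero fun a ha => by
      rcases mul_eq_zero.1 (h0 a ha) with h1 | h1
      · simp [h1]
      · simp [pow_eq_zero_iff (two_ne_zero) |>.1 h1]
    simp [hm0, hc.le]
  have hT' : (0 : ℝ) < T := by exact_mod_cast hT0
  have hg : ∑ a, l a * (h a - m) = 0 := by
    simp_rw [mul_sub, sum_sub_distrib, ← sum_mul, hl.2]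
    simp [hm]
  have hv := sum_prod_mul_sq_sum hl hg T
  have hvar : ∑ a, l a * (h a - m) ^ 2 ≤ S := by
    have h1 : ∑ a, l a * (h a - m) ^ 2 = ∑ a, l a * h a ^ 2 - m ^ 2 := by
      have : ∀ a, l a * (h a - m) ^ 2 = l a * h a ^ 2 - l a * h a * (2 * m) + l a * m ^ 2 := by
        intro a; ring
      simp_rw [this, sum_add_distrib, sum_sub_distrib, ← sum_mul, hl.2, ← hm]
      ring
    rw [h1]
    nlinarith [sq_nonneg m]
  -- The inequality `|z| ≤ z² / (2c) + c / 2` reduces the mean absolute deviation to the variance.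
  have hpt : ∀ o : Fin T → O, |(∑ t, h (o t)) / T - m| ≤
      (∑ t, (h (o t) - m)) ^ 2 / (2 * c * T ^ 2) + c / 2 := by
    intro o
    have h1 : (∑ t, h (o t)) / T - m = (∑ t, (h (o t) - m)) / T := by
      rw [sum_sub_distrib]
      simp
      field_simp
    rw [h1]
    set z := (∑ t, (h (o t) - m)) / T with hz
    have h2 : (∑ t, (h (o t) - m)) ^ 2 / (2 * c * T ^ 2) = |z| ^ 2 / (2 * c) := by
      rw [sq_abs, hz]; field_simp
    rw [h2, div_add_div _ _ (by positivity) (by positivity), le_div_iff₀ (by positivity)]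
    nlinarith [sq_nonneg (|z| - c)]
  calc _ ≤ ∑ o : Fin T → O, (∏ t, l (o t)) *
        ((∑ t, (h (o t) - m)) ^ 2 / (2 * c * T ^ 2) + c / 2) :=
        sum_le_sum fun o _ => mul_le_mul_of_nonneg_left (hpt o) ((prod_mem_stdSimplex hl T).1 o)
    _ = (T * ∑ a, l a * (h a - m) ^ 2) / (2 * c * T ^ 2) + c / 2 := by
        simp_rw [mul_add, sum_add_distrib, ← mul_div_assoc, ← sum_div, hv]
        rw [← sum_mul, (prod_mem_stdSimplex hl T).2, one_mul]
    _ ≤ (T * (T * c ^ 2)) / (2 * c * T ^ 2) + c / 2 := by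
        gcongr
        exact hvar.trans hT
    _ = c := by field_simp; ring

/-- An empirical table may have negative entries or the wrong sum. An `ℓ¹`-closest point of the
simplex is no farther from `v` than `p` is, so the triangle inequality costs a factor 2. -/
theorem exists_nearest_distribution [Fintype C] [Nonempty C] (v : C → ℝ) :
    ∃ w ∈ stdSimplex ℝ C, ∀ p ∈ stdSimplex ℝ C, ∑ j, |w j - p j| ≤ 2 * ∑ j, |v j - p j| := by
  classical
  obtain ⟨w, hw, hmin⟩ := (isCompact_stdSimplex ℝ C).exists_isMinOn
    ⟨_, single_mem_stdSimplex ℝ (Classical.arbitrary C)⟩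
    (f := fun w => ∑ j, |w j - v j|) (by fun_prop)
  refine ⟨w, hw, fun p hp => ?_⟩
  have h1 : ∑ j, |w j - v j| ≤ ∑ j, |p j - v j| := hmin hp
  have h2 : ∑ j, |w j - p j| ≤ ∑ j, |w j - v j| + ∑ j, |v j - p j| := by
    rw [← sum_add_distrib]
    exact sum_le_sum fun j _ => abs_sub_le _ _ _
  have h3 : ∑ j, |p j - v j| = ∑ j, |v j - p j| := sum_congr rfl fun j _ => abs_sub_comm _ _
  linarith

/-- Postprocessing `T` independent samples of unbiased bounded-variance estimators yields a
distribution close to the estimated one. -/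
theorem exists_postprocessing [Fintype O] [Fintype C] [Nonempty C] (h : O → C → ℝ) (T : ℕ) :
    ∃ W : (Fin T → O) → C → ℝ, (∀ o, W o ∈ stdSimplex ℝ C) ∧
      ∀ l ∈ stdSimplex ℝ O, ∀ p ∈ stdSimplex ℝ C, ∀ τ S c : ℝ,
        (∀ j, |∑ a, l a * h a j - p j| ≤ τ) → (∀ j, ∑ a, l a * h a j ^ 2 ≤ S) → 0 < c →
        S ≤ T * c ^ 2 → ∀ E : Finset C,
        |∑ j ∈ E, p j - ∑ j ∈ E, ∑ o : Fin T → O, (∏ t, l (o t)) * W o j| ≤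
          2 * Fintype.card C * (τ + c) := by
  -- The rule depends on the samples alone, not on `l` or `p`, as it must for a referee who does not
  -- know the inputs.
  choose w hw hwp using fun v : C → ℝ => exists_nearest_distribution v
  refine ⟨fun o => w fun j => (∑ t, h (o t) j) / T, fun o => hw _, ?_⟩
  intro l hl p hp τ S c hτ hS hc hT E
  have hP := prod_mem_stdSimplex hl T
  set W : (Fin T → O) → C → ℝ := fun o => w fun j => (∑ t, h (o t) j) / T
  have h1 : ∑ j ∈ E, p j - ∑ j ∈ E, ∑ o : Fin T → O, (∏ t, l (o t)) * W o j =
      ∑ j ∈ E, ∑ o : Fin T → O, (∏ t, l (o t)) * (p j - W o j) := by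
    rw [← sum_sub_distrib]
    refine sum_congr rfl fun j _ => ?_
    simp_rw [mul_sub, sum_sub_distrib, ← sum_mul]
    rw [hP.2, one_mul]
  rw [h1]
  calc |∑ j ∈ E, ∑ o : Fin T → O, (∏ t, l (o t)) * (p j - W o j)|
      ≤ ∑ j ∈ E, ∑ o : Fin T → O, (∏ t, l (o t)) * |W o j - p j| := by
        refine (abs_sum_le_sum_abs _ _).trans (sum_le_sum fun j _ => ?_)
        refine (abs_sum_le_sum_abs _ _).trans (sum_le_sum fun o _ => ?_)
        rw [abs_mul, abs_of_nonneg (hP.1 o), abs_sub_comm]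
    _ ≤ ∑ j, ∑ o : Fin T → O, (∏ t, l (o t)) * |W o j - p j| :=
        sum_le_sum_of_subset_of_nonneg (subset_univ _) fun j _ _ =>
          sum_nonneg fun o _ => mul_nonneg (hP.1 o) (abs_nonneg _)
    _ = ∑ o : Fin T → O, (∏ t, l (o t)) * ∑ j, |W o j - p j| := by
        rw [sum_comm]; simp_rw [mul_sum]
    _ ≤ ∑ o : Fin T → O, (∏ t, l (o t)) * (2 * ∑ j, |(∑ t, h (o t) j) / T - p j|) :=
        sum_le_sum fun o _ => mul_le_mul_of_nonneg_left (hwp _ p hp) (hP.1 o)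
    _ = 2 * ∑ j, ∑ o : Fin T → O, (∏ t, l (o t)) * |(∑ t, h (o t) j) / T - p j| := by
        rw [sum_comm]
        simp_rw [mul_sum]
        refine sum_congr rfl fun o _ => sum_congr rfl fun j _ => ?_
        ring
    _ ≤ 2 * ∑ j : C, (τ + c) := by
        refine mul_le_mul_of_nonneg_left (sum_le_sum fun j _ => ?_) (by norm_num)
        have h2 := sum_prod_mul_abs_avg_sub_le hl (fun a => h a j) (hS j) hc hT
        calc ∑ o : Fin T → O, (∏ t, l (o t)) * |(∑ t, h (o t) j) / T - p j|
            ≤ ∑ o : Fin T → O, ((∏ t, l (o t)) * τ + (∏ t, l (o t)) *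
              |(∑ t, h (o t) j) / T - ∑ a, l a * h a j|) := by
              refine sum_le_sum fun o _ => ?_
              rw [← mul_add]
              refine mul_le_mul_of_nonneg_left ?_ (hP.1 o)
              have := abs_sub_le ((∑ t, h (o t) j) / T) (∑ a, l a * h a j) (p j)
              linarith [hτ j]
          _ ≤ τ + c := by
              rw [sum_add_distrib, ← sum_mul, hP.2, one_mul]
              linarith
    _ = 2 * Fintype.card C * (τ + c) := by
        rw [sum_const, card_univ, nsmul_eq_mul]; ring

theorem exp_le_one_add_add_sq {z : ℝ} (hz : |z| ≤ 1) : Real.exp z ≤ 1 + z + z ^ 2 := by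
  have h := Real.abs_exp_sub_one_sub_id_le hz
  linarith [(abs_le.1 h).2]

/-- Greedy derandomization: for every `R` there are `R` samples for which the sum of the
exponential moments of the deviations is at most its expectation. -/
theorem exists_sum_exp_le {F J : Type*} [Fintype F] [Fintype J] {π : F → ℝ}
    (hπ : π ∈ stdSimplex ℝ F) (Z : J → F → ℝ) (hZ : ∀ j f, |Z j f| ≤ 1) {s : ℝ} (hs : 0 ≤ s)
    (hs1 : s ≤ 1) (R : ℕ) :
    ∃ ω : Fin R → F, ∑ j, Real.exp (s * ∑ i, (Z j (ω i) - ∑ f, π f * Z j f)) ≤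
      Fintype.card J * Real.exp (R * s ^ 2) := by
  induction R with
  | zero => exact ⟨Fin.elim0, by simp⟩
  | succ R ih =>
    obtain ⟨ω, hω⟩ := ih
    -- If every choice of the next sample were too large, so would be the `π`-average; but averaging
    -- multiplies each exponential moment by at most `exp (s²)`.
    by_contra! hcon
    set m : J → ℝ := fun j => ∑ f, π f * Z j f with hm
    -- The factor `exp (-s m)` is kept outside the quadratic expansion, which is thus applied to `s
    -- * Z` with `|s * Z| ≤ 1`; then `1 + s m + s² ≤ exp (s m + s²)`.
    have hmgf : ∀ j, ∑ f, π f * Real.exp (s * (Z j f - m j)) ≤ Real.exp (s ^ 2) := by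
      intro j
      have h1 : ∀ f, π f * Real.exp (s * (Z j f - m j)) ≤
          Real.exp (-(s * m j)) * (π f + s * (π f * Z j f) + π f * s ^ 2) := by
        intro f
        have hb : |s * Z j f| ≤ 1 := by
          rw [abs_mul, abs_of_nonneg hs]
          exact mul_le_one₀ hs1 (abs_nonneg _) (hZ j f)
        have h2 := exp_le_one_add_add_sq hb
        have h3 : (s * Z j f) ^ 2 ≤ s ^ 2 := by
          rw [mul_pow]
          have := (sq_le_one_iff_abs_le_one (Z j f)).2 (hZ j f)
          nlinarith [sq_nonneg s]
        have h4 : s * (Z j f - m j) = -(s * m j) + s * Z j f := by ring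
        rw [h4, Real.exp_add]
        calc π f * (Real.exp (-(s * m j)) * Real.exp (s * Z j f))
            ≤ π f * (Real.exp (-(s * m j)) * (1 + s * Z j f + s ^ 2)) := by
              refine mul_le_mul_of_nonneg_left (mul_le_mul_of_nonneg_left ?_ (Real.exp_nonneg _))
                (hπ.1 f)
              linarith
          _ = _ := by ring
      calc _ ≤ _ := sum_le_sum fun f _ => h1 f
        _ = Real.exp (-(s * m j)) * (s * m j + s ^ 2 + 1) := by
            rw [← mul_sum, sum_add_distrib, sum_add_distrib, ← mul_sum, ← sum_mul, hπ.2]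
            ring
        _ ≤ Real.exp (-(s * m j)) * Real.exp (s * m j + s ^ 2) :=
            mul_le_mul_of_nonneg_left (Real.add_one_le_exp _) (Real.exp_nonneg _)
        _ = Real.exp (s ^ 2) := by rw [← Real.exp_add]; ring_nf
    have hlow : (Fintype.card J : ℝ) * Real.exp ((R + 1 : ℕ) * s ^ 2) <
        ∑ f, π f * ∑ j, Real.exp (s * ∑ i, (Z j ((Fin.cons f ω : Fin (R + 1) → F) i) - m j)) := by
      calc (Fintype.card J : ℝ) * Real.exp ((R + 1 : ℕ) * s ^ 2)
          = ∑ f, π f * ((Fintype.card J : ℝ) * Real.exp ((R + 1 : ℕ) * s ^ 2)) := by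
            rw [← sum_mul, hπ.2, one_mul]
        _ < _ := by
            obtain ⟨f, -, hf⟩ : ∃ f ∈ univ, 0 < π f := by
              refine exists_lt_of_sum_lt (f := fun _ => (0 : ℝ)) ?_
              simp [hπ.2]
            exact sum_lt_sum (fun f _ => mul_le_mul_of_nonneg_left (hcon _).le (hπ.1 f))
              ⟨f, mem_univ _, mul_lt_mul_of_pos_left (hcon _) hf⟩
    refine absurd hlow (not_lt.2 ?_)
    calc ∑ f, π f * ∑ j, Real.exp (s * ∑ i, (Z j ((Fin.cons f ω : Fin (R + 1) → F) i) - m j))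
        = ∑ j, Real.exp (s * ∑ i, (Z j (ω i) - m j)) *
            ∑ f, π f * Real.exp (s * (Z j f - m j)) := by
          simp_rw [mul_sum]
          rw [sum_comm]
          refine sum_congr rfl fun j _ => sum_congr rfl fun f _ => ?_
          rw [Fin.sum_univ_succ]
          simp only [Fin.cons_zero, Fin.cons_succ]
          rw [Real.exp_add]
          ring
      _ ≤ ∑ j, Real.exp (s * ∑ i, (Z j (ω i) - m j)) * Real.exp (s ^ 2) :=
          sum_le_sum fun j _ => mul_le_mul_of_nonneg_left (hmgf j) (Real.exp_nonneg _)
      _ ≤ Fintype.card J * Real.exp (R * s ^ 2) * Real.exp (s ^ 2) := by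
          rw [← sum_mul]
          exact mul_le_mul_of_nonneg_right hω (Real.exp_nonneg _)
      _ = _ := by
          rw [mul_assoc, ← Real.exp_add]
          push_cast
          ring_nf

/-- A mixture is uniformly approximated by an average of few samples. -/
theorem exists_sample_avg_near {F J : Type*} [Fintype F] [Fintype J] {π : F → ℝ}
    (hπ : π ∈ stdSimplex ℝ F) (Z : J → F → ℝ) (hZ : ∀ j f, |Z j f| ≤ 1) {τ : ℝ} (hτ : 0 < τ)
    (hτ1 : τ ≤ 1) {R : ℕ} (hR0 : 0 < R) (hR : Real.log (2 * Fintype.card J) < R * τ ^ 2 / 4) :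
    ∃ ω : Fin R → F, ∀ j, |(∑ i, Z j (ω i)) / R - ∑ f, π f * Z j f| ≤ τ := by
  -- The doubled index set carries `Z` and `-Z`, for two-sided bounds. With `s = τ / 2`, a deviation
  -- above `R τ` would need `R τ² / 2 < log (2|J|) + R τ² / 4`.
  obtain ⟨ω, hω⟩ := exists_sum_exp_le hπ (J := J ⊕ J) (Sum.elim Z fun j f => -Z j f)
    (by rintro (j | j) f <;> simp [hZ j f]) (s := τ / 2) (by linarith) (by linarith) R
  refine ⟨ω, fun j => ?_⟩
  have hR' : (0 : ℝ) < R := by exact_mod_cast hR0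
  have hJ : (0 : ℝ) < Fintype.card J := by
    have : Nonempty J := ⟨j⟩
    exact_mod_cast Fintype.card_pos
  have key : ∀ k : J ⊕ J, (∑ i, (Sum.elim Z (fun j f => -Z j f) k (ω i) -
      ∑ f, π f * Sum.elim Z (fun j f => -Z j f) k f)) ≤ R * τ := by
    intro k
    have h1 := (single_le_sum (f := fun k => Real.exp (τ / 2 * ∑ i,
      (Sum.elim Z (fun j f => -Z j f) k (ω i) - ∑ f, π f * Sum.elim Z (fun j f => -Z j f) k f)))
      (fun _ _ => Real.exp_nonneg _) (mem_univ k)).trans hω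
    have h2 : (Fintype.card (J ⊕ J) : ℝ) = Real.exp (Real.log (2 * Fintype.card J)) := by
      rw [Real.exp_log (by positivity)]
      simp [Fintype.card_sum, two_mul]
    rw [h2, ← Real.exp_add, Real.exp_le_exp] at h1
    by_contra! hc
    nlinarith
  rw [abs_le]
  have e1 := key (Sum.inl j)
  have e2 := key (Sum.inr j)
  simp only [Sum.elim_inl, Sum.elim_inr, sum_sub_distrib, sum_const, card_univ, Fintype.card_fin,
    nsmul_eq_mul, mul_neg, sum_neg_distrib] at e1 e2
  constructor
  · rw [neg_le_sub_iff_le_add, ← sub_le_iff_le_add, le_div_iff₀ hR']; nlinarith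
  · rw [sub_le_iff_le_add, div_le_iff₀ hR']; nlinarith

end Sampling

/-! ### The protocol with shared randomness -/

section PublicCoin

open Finset

/-- Independent draws pushed forward through `φ` are independent draws from the pushforward law;
this puts the protocol in the form needed by `exists_postprocessing`. -/
theorem sum_prod_comp {F O : Type*} [Fintype F] [Fintype O] [DecidableEq O] {T : ℕ} (π : F → ℝ)
    (φ : F → O) (G : (Fin T → O) → ℝ) :
    ∑ r : Fin T → F, (∏ t, π (r t)) * G (fun t => φ (r t)) =
      ∑ o : Fin T → O, (∏ t, ∑ f, if φ f = o t then π f else 0) * G o := by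
  simp_rw [← sum_fun_prod (fun t f => if φ f = _ then π f else 0), sum_mul]
  rw [sum_comm]
  refine sum_congr rfl fun r _ => ?_
  rw [sum_eq_single (fun t => φ (r t))]
  · simp
  · intro o _ ho
    obtain ⟨t, ht⟩ := Function.ne_iff.1 ho
    rw [prod_eq_zero (mem_univ t) (if_neg (Ne.symm ht)), zero_mul]
  · simp

theorem sum_pushforward_mul {F O : Type*} [Fintype F] [Fintype O] [DecidableEq O] (π : F → ℝ)
    (φ : F → O) (h : O → ℝ) :
    ∑ o, (∑ f, if φ f = o then π f else 0) * h o = ∑ f, π f * h (φ f) := by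
  simp_rw [sum_mul]
  rw [sum_comm]
  simp [ite_mul]

theorem pushforward_mem_stdSimplex {F O : Type*} [Fintype F] [Fintype O] [DecidableEq O]
    {π : F → ℝ} (hπ : π ∈ stdSimplex ℝ F) (φ : F → O) :
    (fun o => ∑ f, if φ f = o then π f else 0) ∈ stdSimplex ℝ O := by
  refine ⟨fun o => sum_nonneg fun f _ => ?_, ?_⟩
  · split_ifs
    exacts [hπ.1 f, le_rfl]
  · have := sum_pushforward_mul π φ (fun _ => 1)
    simpa [hπ.2] using this

theorem abs_div_sum_mem_stdSimplex {F : Type*} [Fintype F] {c : F → ℝ} (hc : 0 < ∑ f, |c f|) :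
    (fun f => |c f| / ∑ f, |c f|) ∈ stdSimplex ℝ F :=
  ⟨fun f => by positivity, by rw [← sum_div, div_self hc.ne']⟩

theorem exists_encoding_of_card_le {S : Type*} [Fintype S] [Nonempty S] {k : ℕ}
    (h : Fintype.card S ≤ 2 ^ k) :
    ∃ (e : S → BitString k) (d : BitString k → S), ∀ s, d (e s) = s := by
  obtain ⟨e⟩ := Function.Embedding.nonempty_of_card_le (α := S) (β := BitString k) (by simpa using h)
  exact ⟨e, Function.invFun e, Function.leftInverse_invFun e.injective⟩

/-- The sign of `c`, encoded as a Boolean. -/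
noncomputable def signBit (c : ℝ) : Bool := decide (0 ≤ c)

/-- The number `±1` encoded by a Boolean. -/
def bitSign (s : Bool) : ℝ := if s then 1 else -1

theorem abs_mul_bitSign (c : ℝ) : |c| * bitSign (signBit c) = c := by
  by_cases h : 0 ≤ c
  · simp [bitSign, signBit, h, abs_of_nonneg h]
  · simp [bitSign, signBit, h, abs_of_neg (not_le.1 h)]

theorem bitSign_sq (s : Bool) : bitSign s ^ 2 = 1 := by
  cases s <;> simp [bitSign]

theorem abs_bitSign (s : Bool) : |bitSign s| = 1 := by
  cases s <;> simp [bitSign]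

theorem clog_le_logb_add_one {a : ℕ} (ha : 1 ≤ a) :
    (Nat.clog 2 a : ℝ) ≤ Real.logb 2 a + 1 := by
  rw [← Real.natCeil_logb_natCast]
  exact (Nat.ceil_lt_add_one (Real.logb_nonneg (by norm_num) (by exact_mod_cast ha))).le

theorem IsNonSignaling.nonempty_output {X Y A B : Type*} [Fintype A] [Fintype B] [Nonempty X]
    [Nonempty Y] {p : Behavior X Y A B} (hp : IsNonSignaling p) :
    Nonempty (A × B) := by
  by_contra h
  rw [not_nonempty_iff] at h
  have := (hp.isDistribution (Classical.arbitrary X) (Classical.arbitrary Y)).2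
  simp at this

/-- When `AB = 1` the factor `log₂ (AB)` vanishes, so the bound demands a protocol with no
communication. -/
theorem publicCoinComplexity_eq_zero {X Y A B : Type*} [Fintype A] [Fintype B] [Nonempty X]
    [Nonempty Y] {p : Behavior X Y A B} (hp : IsNonSignaling p) {ε : ℝ}
    (hε : 0 ≤ ε) (h1 : Fintype.card (A × B) = 1) : publicCoinComplexity ε p = 0 := by
  obtain ⟨ab₀, h0⟩ := Fintype.card_eq_one_iff.1 h1
  have hv : ∀ x y ab, p x y ab = 1 := by
    intro x y ab
    have := (hp.isDistribution x y).2
    rw [Fintype.sum_eq_single ab₀ (fun ab h => absurd (h0 ab) h)] at this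
    rw [h0 ab, this]
  let x₀ : X := Classical.arbitrary X
  let y₀ : Y := Classical.arbitrary Y
  let P : PublicCoinProtocol X Y A B 0 0 :=
    { m := 1
      μ := fun _ => 1
      μ_mem := by simp [stdSimplex]
      alice := fun _ _ _ => 1
      alice_mem := fun _ _ => by simp [stdSimplex]
      bob := fun _ _ _ => 1
      bob_mem := fun _ _ => by simp [stdSimplex]
      referee := fun _ _ => p x₀ y₀
      referee_mem := fun _ _ => hp.isDistribution _ _ }
  have hP : P.output = p := by
    funext x y ab
    simp [PublicCoinProtocol.output, P, hv]
  refine Nat.le_zero.1 (Nat.sInf_le ⟨0, 0, P, ?_, rfl⟩)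
  rw [hP, tvDist_self]
  exact hε

variable {X Y A B : Type*} [Fintype X] [Fintype Y] [Fintype A] [Fintype B]
  [DecidableEq X] [DecidableEq Y] [Nonempty X] [Nonempty Y]

theorem exists_publicCoinProtocol {p : Behavior X Y A B} (hp : IsNonSignaling p)
    {c : (X → A) × (Y → B) → ℝ} (hc : p = ∑ fg, c fg • localDeterministic fg.1 fg.2)
    {T : ℕ} {κ : ℝ} (hκ : 0 < κ) (hT : (∑ fg, |c fg|) ^ 2 ≤ T * κ ^ 2) :
    ∃ π : PublicCoinProtocol X Y A B (T * (Nat.clog 2 (Fintype.card A) + 1))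
        (T * Nat.clog 2 (Fintype.card B)),
      ∀ x y (E : Finset (A × B)), |∑ ab ∈ E, p x y ab - ∑ ab ∈ E, π.output x y ab| ≤
        2 * Fintype.card (A × B) * κ := by
  classical
  have hne := hp.nonempty_output
  have : Nonempty A := hne.map Prod.fst
  have : Nonempty B := hne.map Prod.snd
  set L := ∑ fg, |c fg| with hL
  have hL1 : 1 ≤ L := one_le_sum_abs_of_signed_model hp hc
  have hL0 : 0 < L := by linarith
  have hπ := abs_div_sum_mem_stdSimplex (c := c) hL0
  set π : (X → A) × (Y → B) → ℝ := fun f => |c f| / L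
  obtain ⟨eA, dA, hA⟩ := exists_encoding_of_card_le (S := Fin T → Bool × A)
    (k := T * (Nat.clog 2 (Fintype.card A) + 1)) (by
      simp only [Fintype.card_pi, Fintype.card_prod, Fintype.card_bool, prod_const, card_univ,
        Fintype.card_fin]
      rw [mul_comm T, pow_mul, pow_succ']
      exact Nat.pow_le_pow_left (Nat.mul_le_mul_left _ (Nat.le_pow_clog one_lt_two _)) _)
  obtain ⟨eB, dB, hB⟩ := exists_encoding_of_card_le (S := Fin T → B)
    (k := T * Nat.clog 2 (Fintype.card B)) (by
      simp only [Fintype.card_pi, prod_const, card_univ, Fintype.card_fin]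
      rw [mul_comm T, pow_mul]
      exact Nat.pow_le_pow_left (Nat.le_pow_clog one_lt_two _) _)
  -- One sample is the sign and the two answers. Both players know the sign from the shared draw;
  -- Alice sends it, at the price of one bit.
  obtain ⟨W, hW, hWp⟩ := exists_postprocessing (O := Bool × A × B) (C := A × B)
    (fun o ab => L * (bitSign o.1 * if o.2 = ab then 1 else 0)) T
  let e := (Fintype.equivFin (Fin T → (X → A) × (Y → B))).symm
  let P : PublicCoinProtocol X Y A B (T * (Nat.clog 2 (Fintype.card A) + 1))
      (T * Nat.clog 2 (Fintype.card B)) :=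
    { m := _
      μ := fun r => ∏ t, π (e r t)
      μ_mem := ⟨fun r => (prod_mem_stdSimplex hπ T).1 (e r), by
        rw [e.sum_comp (fun r => ∏ t, π (r t))]
        exact (prod_mem_stdSimplex hπ T).2⟩
      alice := fun r x => Pi.single (eA fun t => (signBit (c (e r t)), (e r t).1 x)) 1
      alice_mem := fun _ _ => single_mem_stdSimplex ℝ _
      bob := fun r y => Pi.single (eB fun t => (e r t).2 y) 1
      bob_mem := fun _ _ => single_mem_stdSimplex ℝ _
      referee := fun s s' => W fun t => ((dA s t).1, (dA s t).2, dB s' t)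
      referee_mem := fun s s' => hW _ }
  let φ : X → Y → (X → A) × (Y → B) → Bool × A × B :=
    fun x y f => (signBit (c f), f.1 x, f.2 y)
  have hout : ∀ x y ab, P.output x y ab =
      ∑ o : Fin T → Bool × A × B, (∏ t, ∑ f, if φ x y f = o t then π f else 0) * W o ab := by
    intro x y ab
    rw [← sum_prod_comp π (φ x y) (fun o => W o ab), ← e.sum_comp]
    simp [PublicCoinProtocol.output, P, Pi.single_apply, hA, hB, φ]
  refine ⟨P, fun x y E => ?_⟩
  simp_rw [hout x y]
  have hpx : ∀ ab, ∑ f, π f * (L * (bitSign (φ x y f).1 * if (φ x y f).2 = ab then 1 else 0)) =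
      p x y ab := by
    intro ab
    rw [hc]
    simp only [Finset.sum_apply, Pi.smul_apply, smul_eq_mul]
    refine sum_congr rfl fun f _ => ?_
    calc _ = |c f| * bitSign (signBit (c f)) * (if (f.1 x, f.2 y) = ab then 1 else 0) := by
          simp only [π, φ]; field_simp
      _ = _ := by
          rw [abs_mul_bitSign]
          simp only [localDeterministic, eq_comm (a := ab)]
  have := hWp _ (pushforward_mem_stdSimplex hπ (φ x y)) (p x y) (hp.isDistribution x y) 0 (L ^ 2) κ
    (fun ab => by rw [sum_pushforward_mul π (φ x y), hpx, sub_self, abs_zero])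
    (fun ab => by
      rw [sum_pushforward_mul π (φ x y) (fun o => (L * (bitSign o.1 * if o.2 = ab then 1 else 0)) ^ 2)]
      calc _ ≤ ∑ f, π f * L ^ 2 := by
            refine sum_le_sum fun f _ => mul_le_mul_of_nonneg_left ?_ (hπ.1 f)
            rw [mul_pow, mul_pow, bitSign_sq]
            split_ifs <;> simp [sq_nonneg]
        _ = L ^ 2 := by rw [← sum_mul, hπ.2, one_mul]) hκ hT E
  simpa using this

theorem publicCoinComplexity_le {p p' : Behavior X Y A B} (hp' : IsNonSignaling p') {ε δ : ℝ}
    (hd : tvDist p p' ≤ ε) (hδ : 0 < δ) (hδ2 : δ < 1 / 2)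
    {c : (X → A) × (Y → B) → ℝ} (hc : p' = ∑ fg, c fg • localDeterministic fg.1 fg.2)
    (h2 : 2 ≤ Fintype.card A * Fintype.card B) :
    (publicCoinComplexity (ε + δ) p : ℝ) ≤
      16 * ((Fintype.card A : ℝ) * (Fintype.card B : ℝ) * (∑ fg, |c fg|) / δ) ^ 2
        * Real.log (4 * ((Fintype.card A : ℝ) * (Fintype.card B : ℝ)) / δ)
        * Real.logb 2 ((Fintype.card A : ℝ) * (Fintype.card B : ℝ)) := by
  have hL1 : 1 ≤ ∑ fg, |c fg| := one_le_sum_abs_of_signed_model hp' hc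
  set L := ∑ fg, |c fg|
  have hN : (2 : ℝ) ≤ (Fintype.card A : ℝ) * (Fintype.card B : ℝ) := by exact_mod_cast h2
  have hA1 : 1 ≤ Fintype.card A := Nat.pos_of_ne_zero (by rintro h; simp [h] at h2)
  have hB1 : 1 ≤ Fintype.card B := Nat.pos_of_ne_zero (by rintro h; simp [h] at h2)
  set N := (Fintype.card A : ℝ) * (Fintype.card B : ℝ) with hNdef
  set M := N * L / δ with hM
  set T := ⌈4 * M ^ 2⌉₊
  have hT1 : 4 * M ^ 2 ≤ T := Nat.le_ceil _
  have hT2 : (T : ℝ) ≤ 4 * M ^ 2 + 1 := (Nat.ceil_lt_add_one (by positivity)).le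
  -- With `κ = δ / (2N)` the error `2 N κ` is exactly `δ`, and `T ≥ L² / κ²` becomes `T ≥ 4 M²`.
  obtain ⟨π, hπ⟩ := exists_publicCoinProtocol hp' hc (T := T) (κ := δ / (2 * N)) (by positivity) (by
    calc L ^ 2 = 4 * M ^ 2 * (δ / (2 * N)) ^ 2 := by rw [hM]; field_simp; ring
      _ ≤ _ := by gcongr)
  have hcost : publicCoinComplexity (ε + δ) p ≤
      T * (Nat.clog 2 (Fintype.card A) + 1) + T * Nat.clog 2 (Fintype.card B) := by
    refine Nat.sInf_le ⟨_, _, π, tvDist_le_add hd fun x y E => (hπ x y E).trans (le_of_eq ?_), rfl⟩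
    rw [Fintype.card_prod]
    push_cast
    rw [← hNdef]
    field_simp
  have hcA := clog_le_logb_add_one hA1
  have hcB := clog_le_logb_add_one hB1
  have hlog : Real.logb 2 (Fintype.card A) + Real.logb 2 (Fintype.card B) = Real.logb 2 N := by
    rw [hNdef, Real.logb_mul (by positivity) (by positivity)]
  have hl1 : 1 ≤ Real.logb 2 N := by
    rw [Real.le_logb_iff_rpow_le (by norm_num) (by linarith)]
    simpa using hN
  have hM4 : 4 ≤ M := by
    rw [hM, le_div_iff₀ hδ]
    nlinarith
  -- This is all that is needed of the logarithm: it absorbs the rounding of `T` and the per-sample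
  -- overhead `log₂ N + 3 ≤ 4 log₂ N`.
  have hln : 2 ≤ Real.log (4 * N / δ) := by
    have h16 : (16 : ℝ) ≤ 4 * N / δ := by
      rw [le_div_iff₀ hδ]; linarith
    have h4 : Real.log 16 = 4 * Real.log 2 := by
      rw [show (16 : ℝ) = 2 ^ 4 by norm_num, Real.log_pow]; norm_num
    have := Real.log_two_gt_d9
    have := Real.log_le_log (by norm_num) h16
    linarith
  calc (publicCoinComplexity (ε + δ) p : ℝ)
      ≤ T * (Nat.clog 2 (Fintype.card A) + 1) + T * Nat.clog 2 (Fintype.card B) := by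
        exact_mod_cast hcost
    _ = T * (Nat.clog 2 (Fintype.card A) + Nat.clog 2 (Fintype.card B) + 1) := by ring
    _ ≤ (4 * M ^ 2 + 1) * (4 * Real.logb 2 N) := by
        gcongr
        linarith
    _ = (16 * M ^ 2 + 4) * Real.logb 2 N := by ring
    _ ≤ 16 * M ^ 2 * 2 * Real.logb 2 N := by
        gcongr
        nlinarith
    _ ≤ 16 * M ^ 2 * Real.log (4 * N / δ) * Real.logb 2 N := by gcongr

end PublicCoin

/-! ### Tensor powers of matrices -/

section TensorPower

open Finset Matrix

open scoped MatrixOrder Matrix.Norms.L2Operator in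
theorem _root_.Matrix.PosSemidef.exists_eq_conjTranspose_mul_self {S : Type*} [Fintype S]
    {M : Matrix S S ℂ} (hM : M.PosSemidef) : ∃ B : Matrix S S ℂ, M = Bᴴ * B := by
  classical
  exact CStarAlgebra.nonneg_iff_eq_star_mul_self.mp hM.nonneg

/-- The tensor product of a finite sequence of matrices. -/
def piTensor {T : ℕ} {S S' : Type*} (M : Fin T → Matrix S S' ℂ) :
    Matrix (Fin T → S) (Fin T → S') ℂ :=
  Matrix.of fun s s' => ∏ t, M t (s t) (s' t)

variable {T : ℕ} {S : Type*}

theorem sum_piTensor {O : Type*} [Fintype O] (M : O → Matrix S S ℂ) :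
    ∑ o : Fin T → O, piTensor (fun t => M (o t)) = piTensor fun _ => ∑ o, M o := by
  ext s s'
  simp only [piTensor, Matrix.sum_apply, of_apply]
  exact sum_fun_prod (fun t o => M o (s t) (s' t))

theorem piTensor_one [DecidableEq S] : piTensor (fun _ : Fin T => (1 : Matrix S S ℂ)) = 1 := by
  ext s s'
  simp only [piTensor, of_apply, one_apply, prod_ite_zero, prod_const_one, mem_univ, forall_true_left,
    funext_iff]

variable [Fintype S]

theorem piTensor_mul (M N : Fin T → Matrix S S ℂ) :
    piTensor M * piTensor N = piTensor fun t => M t * N t := by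
  ext s s'
  simp only [piTensor, mul_apply, of_apply, ← prod_mul_distrib]
  exact sum_fun_prod (fun t a => M t (s t) a * N t a (s' t))

theorem trace_piTensor (M : Fin T → Matrix S S ℂ) :
    (piTensor M).trace = ∏ t, (M t).trace := by
  simp only [piTensor, trace, diag_apply, of_apply]
  exact sum_fun_prod (fun t a => M t a a)

theorem posSemidef_piTensor {M : Fin T → Matrix S S ℂ} (hM : ∀ t, (M t).PosSemidef) :
    (piTensor M).PosSemidef := by
  classical
  choose N hN using fun t => (hM t).exists_eq_conjTranspose_mul_self
  have : piTensor M = (piTensor N)ᴴ * piTensor N := by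
    have h1 : (piTensor N)ᴴ = piTensor fun t => (N t)ᴴ := by
      ext s s'
      simp [piTensor]
    rw [h1, piTensor_mul]
    congr
    funext t
    exact hN t
  rw [this]
  exact posSemidef_conjTranspose_mul_self _

theorem trace_mul_nonneg_of_posSemidef {M N : Matrix S S ℂ} (hM : M.PosSemidef)
    (hN : N.PosSemidef) : 0 ≤ (M * N).trace := by
  classical
  obtain ⟨B, rfl⟩ := hM.exists_eq_conjTranspose_mul_self
  rw [Matrix.mul_assoc, trace_mul_comm]
  exact (hN.mul_mul_conjTranspose_same B).trace_nonneg

theorem trace_submatrix_equiv' {S' : Type*} [Fintype S'] (M : Matrix S S ℂ) (e : S' ≃ S) :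
    (M.submatrix e e).trace = M.trace := by
  simp only [trace, diag_apply, submatrix_apply]
  exact e.sum_comp fun s => M s s

end TensorPower

/-! ### Independent repetition of a quantum measurement -/

section Repetition

open Finset Matrix

/-- A measurement of product states with finitely many outcomes `O`, on arbitrary finite
registers. -/
structure ProductMeasurement (X Y O SA SB : Type*) [Fintype O] [Fintype SA] [Fintype SB]
    [DecidableEq SA] [DecidableEq SB] where
  alice : X → Matrix SA SA ℂ
  alice_posSemidef : ∀ x, (alice x).PosSemidef
  alice_trace : ∀ x, (alice x).trace = 1
  bob : Y → Matrix SB SB ℂ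
  bob_posSemidef : ∀ y, (bob y).PosSemidef
  bob_trace : ∀ y, (bob y).trace = 1
  povm : O → Matrix (SA × SB) (SA × SB) ℂ
  povm_posSemidef : ∀ o, (povm o).PosSemidef
  povm_sum : ∑ o, povm o = 1

variable {X Y O SA SB : Type*} [Fintype O] [Fintype SA] [Fintype SB]
    [DecidableEq SA] [DecidableEq SB]

/-- The outcome distribution of a measurement of product states. -/
def ProductMeasurement.law (π : ProductMeasurement X Y O SA SB) (x : X) (y : Y) (o : O) : ℝ :=
  (π.povm o * (π.alice x ⊗ₖ π.bob y)).trace.re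

/-- The trace of a product of two positive semidefinite matrices is real, so taking the real part
loses nothing and laws can be computed in `ℂ`. -/
theorem ProductMeasurement.ofReal_law (π : ProductMeasurement X Y O SA SB) (x : X) (y : Y)
    (o : O) : (π.law x y o : ℂ) = (π.povm o * (π.alice x ⊗ₖ π.bob y)).trace := by
  have h := trace_mul_nonneg_of_posSemidef (π.povm_posSemidef o)
    ((π.alice_posSemidef x).kronecker (π.bob_posSemidef y))
  exact (Complex.eq_re_of_ofReal_le h).symm

theorem ProductMeasurement.law_mem_stdSimplex (π : ProductMeasurement X Y O SA SB) (x : X)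
    (y : Y) : π.law x y ∈ stdSimplex ℝ O := by
  constructor
  · intro o
    have h := trace_mul_nonneg_of_posSemidef (π.povm_posSemidef o)
      ((π.alice_posSemidef x).kronecker (π.bob_posSemidef y))
    exact (Complex.le_def.1 h).1
  · rw [← Complex.ofReal_inj]
    push_cast
    simp_rw [π.ofReal_law]
    rw [← trace_sum, ← Finset.sum_mul, π.povm_sum, one_mul, trace_kronecker, π.alice_trace,
      π.bob_trace, one_mul]

/-- Measuring `T` copies of the product states independently and postprocessing the outcomes
classically is again a quantum protocol. -/
theorem ProductMeasurement.exists_repetition {A B : Type*} [Fintype A] [Fintype B]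
    (π : ProductMeasurement X Y O SA SB) {kA kB : ℕ} (hA : Fintype.card SA = 2 ^ kA)
    (hB : Fintype.card SB = 2 ^ kB) {T : ℕ} (W : (Fin T → O) → A × B → ℝ)
    (hW : ∀ o, W o ∈ stdSimplex ℝ (A × B)) :
    ∃ Q : QuantumProtocol X Y A B (T * kA) (T * kB),
      ∀ x y ab, Q.output x y ab = ∑ o : Fin T → O, (∏ t, π.law x y (o t)) * W o ab := by
  classical
  -- Exact cardinalities give bijections with bit strings, so the reindexed effects still sum to the
  -- identity.
  let eA : BitString (T * kA) ≃ (Fin T → SA) := Fintype.equivOfCardEq (by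
    simp [hA, ← pow_mul, mul_comm])
  let eB : BitString (T * kB) ≃ (Fin T → SB) := Fintype.equivOfCardEq (by
    simp [hB, ← pow_mul, mul_comm])
  let e : BitString (T * kA) × BitString (T * kB) ≃ (Fin T → SA × SB) :=
    (eA.prodCongr eB).trans (Equiv.arrowProdEquivProdArrow (Fin T) (fun _ => SA) (fun _ => SB)).symm
  let Q : QuantumProtocol X Y A B (T * kA) (T * kB) :=
    { alice := fun x => (piTensor fun _ => π.alice x).submatrix eA eA
      alice_posSemidef := fun x => (posSemidef_piTensor fun _ => π.alice_posSemidef x).submatrix _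
      alice_trace := fun x => by
        rw [trace_submatrix_equiv', trace_piTensor]; simp [π.alice_trace]
      bob := fun y => (piTensor fun _ => π.bob y).submatrix eB eB
      bob_posSemidef := fun y => (posSemidef_piTensor fun _ => π.bob_posSemidef y).submatrix _
      bob_trace := fun y => by
        rw [trace_submatrix_equiv', trace_piTensor]; simp [π.bob_trace]
      povm := fun ab => ∑ o : Fin T → O,
        (W o ab : ℂ) • (piTensor fun t => π.povm (o t)).submatrix e e
      povm_posSemidef := fun ab => posSemidef_sum _ fun o _ =>
        ((posSemidef_piTensor fun t => π.povm_posSemidef (o t)).submatrix _).smul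
          (Complex.zero_le_real.2 ((hW o).1 ab))
      povm_sum := by
        rw [sum_comm]
        have h1 : ∀ o, ∑ ab, (W o ab : ℂ) = 1 := fun o => by exact_mod_cast (hW o).2
        simp_rw [← Finset.sum_smul, h1, one_smul]
        have h2 := congrArg (fun M => M.submatrix e e)
          ((sum_piTensor (T := T) π.povm).trans (by rw [π.povm_sum, piTensor_one]))
        ext s s'
        have h3 := congrFun (congrFun h2 s) s'
        simpa [Matrix.sum_apply, one_apply] using h3 }
  refine ⟨Q, fun x y ab => ?_⟩
  have hK : Q.alice x ⊗ₖ Q.bob y = (piTensor fun _ => π.alice x ⊗ₖ π.bob y).submatrix e e := by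
    ext ⟨s, t⟩ ⟨s', t'⟩
    simp [Q, piTensor, e, kroneckerMap_apply, prod_mul_distrib, Equiv.arrowProdEquivProdArrow]
  rw [← Complex.ofReal_inj]
  push_cast
  simp_rw [π.ofReal_law]
  have htr : (Q.povm ab * (Q.alice x ⊗ₖ Q.bob y)).trace =
      ∑ o : Fin T → O, (∏ t, (π.povm (o t) * (π.alice x ⊗ₖ π.bob y)).trace) * (W o ab : ℂ) := by
    rw [hK]
    simp only [Q, Finset.sum_mul, trace_sum]
    refine sum_congr rfl fun o _ => ?_
    rw [smul_mul, trace_smul, submatrix_mul_equiv, trace_submatrix_equiv', piTensor_mul,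
      trace_piTensor, smul_eq_mul, mul_comm]
  rw [← htr]
  have h := trace_mul_nonneg_of_posSemidef (Q.povm_posSemidef ab)
    ((Q.alice_posSemidef x).kronecker (Q.bob_posSemidef y))
  exact (Complex.eq_re_of_ofReal_le h).symm

end Repetition

/-! ### Measuring interference between two families of basis vectors -/

section Interference

open Finset Matrix

/-- The pure state with real amplitudes `v`. -/
def realPure {S : Type*} (v : S → ℝ) : Matrix S S ℂ :=
  Matrix.of fun s s' => ((v s * v s' : ℝ) : ℂ)

theorem posSemidef_realPure {S : Type*} [Fintype S] (v : S → ℝ) : (realPure v).PosSemidef := by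
  have h : realPure v = vecMulVec (fun s => (v s : ℂ)) (star fun s => (v s : ℂ)) := by
    ext s s'
    simp [realPure, vecMulVec_apply]
  rw [h]
  exact posSemidef_vecMulVec_self_star _

theorem trace_realPure {S : Type*} [Fintype S] {v : S → ℝ} (hv : ∑ s, v s ^ 2 = 1) :
    (realPure v).trace = 1 := by
  simp only [realPure, trace, diag_apply, of_apply, ← sq]
  exact_mod_cast hv

/-- The matrix whose columns are the basis vectors `u i`. -/
def basisColumns {S I : Type*} [DecidableEq S] (u : I → S) : Matrix S I ℂ :=
  Matrix.of fun s i => if s = u i then 1 else 0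

/-- The partial exchange of the basis vectors `u i` and `w i`. -/
def exchange {S I : Type*} [DecidableEq S] [Fintype I] (u w : I → S) : Matrix S S ℂ :=
  basisColumns u * (basisColumns w)ᴴ + basisColumns w * (basisColumns u)ᴴ

variable {S I : Type*} [Fintype S] [DecidableEq S]

theorem basisColumns_conjTranspose_mul_self [DecidableEq I] {u : I → S} (hu : Function.Injective u) :
    (basisColumns u)ᴴ * basisColumns u = 1 := by
  ext i j
  simp [basisColumns, mul_apply, one_apply, hu.eq_iff, eq_comm]

theorem basisColumns_conjTranspose_mul_eq_zero {u w : I → S} (h : ∀ i j, u i ≠ w j) :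
    (basisColumns u)ᴴ * basisColumns w = 0 := by
  ext i j
  simp [basisColumns, mul_apply, (h i j).symm]

theorem trace_basisColumns_mul [Fintype I] (u w : I → S) (K : Matrix S S ℂ) :
    (basisColumns u * (basisColumns w)ᴴ * K).trace = ∑ i, K (w i) (u i) := by
  rw [Matrix.mul_assoc, trace_mul_comm]
  simp [basisColumns, trace, mul_apply]

/-- Let `V`, `W` have the columns `u i`, `w i`, and let `P` project onto their span. Orthonormality
gives `1 + ε (V Wᴴ + W Vᴴ) = (1 - P)(1 - P)ᴴ + (V + ε W)(V + ε W)ᴴ` for `ε = ±1`. -/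
theorem posSemidef_one_add_smul_exchange [Fintype I] [DecidableEq I] {u w : I → S} (hu : Function.Injective u)
    (hw : Function.Injective w) (h : ∀ i j, u i ≠ w j) {ε : ℂ} (hε : star ε = ε) (hε2 : ε * ε = 1) :
    (1 + ε • exchange u w).PosSemidef := by
  have hVV := basisColumns_conjTranspose_mul_self hu
  have hWW := basisColumns_conjTranspose_mul_self hw
  have hVW := basisColumns_conjTranspose_mul_eq_zero h
  have hWV := basisColumns_conjTranspose_mul_eq_zero fun i j => (h j i).symm
  unfold exchange
  set V : Matrix S I ℂ := basisColumns u
  set W : Matrix S I ℂ := basisColumns w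
  set P := V * Vᴴ + W * Wᴴ with hP
  have hPP : P * P = P := by
    simp only [hP, Matrix.mul_add, Matrix.add_mul]
    have h1 : V * Vᴴ * (V * Vᴴ) = V * Vᴴ := by
      rw [Matrix.mul_assoc, ← Matrix.mul_assoc Vᴴ, hVV, Matrix.one_mul]
    have h2 : W * Wᴴ * (W * Wᴴ) = W * Wᴴ := by
      rw [Matrix.mul_assoc, ← Matrix.mul_assoc Wᴴ, hWW, Matrix.one_mul]
    have h3 : V * Vᴴ * (W * Wᴴ) = 0 := by
      rw [Matrix.mul_assoc, ← Matrix.mul_assoc Vᴴ, hVW, Matrix.zero_mul, Matrix.mul_zero]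
    have h4 : W * Wᴴ * (V * Vᴴ) = 0 := by
      rw [Matrix.mul_assoc, ← Matrix.mul_assoc Wᴴ, hWV, Matrix.zero_mul, Matrix.mul_zero]
    rw [h1, h2, h3, h4, add_zero, zero_add]
  have hPH : Pᴴ = P := by
    simp [hP, conjTranspose_add, conjTranspose_mul]
  have e1 : (1 - P) * (1 - P)ᴴ = 1 - P := by
    rw [conjTranspose_sub, hPH, conjTranspose_one, Matrix.mul_sub, Matrix.sub_mul, Matrix.sub_mul, hPP]
    simp
  have e2 : (V + ε • W) * (V + ε • W)ᴴ = P + ε • (V * Wᴴ + W * Vᴴ) := by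
    rw [conjTranspose_add, conjTranspose_smul, hε]
    simp only [Matrix.mul_add, Matrix.add_mul, Matrix.mul_smul, Matrix.smul_mul, smul_smul, hε2,
      one_smul, hP, smul_add]
    abel
  have e3 : 1 + ε • (V * Wᴴ + W * Vᴴ) =
      (1 - P) * (1 - P)ᴴ + (V + ε • W) * (V + ε • W)ᴴ := by
    rw [e1, e2]
    abel
  rw [e3]
  exact (posSemidef_self_mul_conjTranspose _).add (posSemidef_self_mul_conjTranspose _)

end Interference

/-! ### Fingerprint states and their measurement -/

section Fingerprint

open Finset Matrix

/-- The amplitudes of `(|0, d⟩ + |I|^{-1/2} ∑ᵢ sᵢ |1, i, fᵢ⟩) / √2`. -/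
noncomputable def fingerprint {I Q : Type*} [Fintype I] [DecidableEq I] [DecidableEq Q] (d : I × Q)
    (f : I → Q) (s : I → Bool) : Bool × I × Q → ℝ :=
  fun z => if z.1 then (if z.2.2 = f z.2.1 then bitSign (s z.2.1) * (√(2 * Fintype.card I))⁻¹ else 0)
    else if z.2 = d then (√2)⁻¹ else 0

theorem sum_fingerprint_sq {I Q : Type*} [Fintype I] [DecidableEq I] [Fintype Q] [DecidableEq Q]
    (d : I × Q) (f : I → Q) (s : I → Bool) : ∑ z, fingerprint d f s z ^ 2 = 1 := by
  have hI : (Fintype.card I : ℝ) ≠ 0 := by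
    have : Nonempty I := ⟨d.1⟩
    exact_mod_cast Fintype.card_ne_zero
  have h2 : ((√(2 * Fintype.card I))⁻¹) ^ 2 = (2 * (Fintype.card I : ℝ))⁻¹ := by
    rw [inv_pow, Real.sq_sqrt (by positivity)]
  have h3 : ((√2 : ℝ)⁻¹) ^ 2 = 2⁻¹ := by
    rw [inv_pow, Real.sq_sqrt (by norm_num)]
  rw [Fintype.sum_prod_type, Fintype.sum_bool, Fintype.sum_prod_type]
  simp only [fingerprint, if_true, Bool.false_eq_true, if_false, ite_pow, mul_pow, bitSign_sq, h2,
    h3, one_mul, ne_eq, OfNat.ofNat_ne_zero, not_false_eq_true, zero_pow, sum_ite_eq', mem_univ,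
    sum_const, card_univ, nsmul_eq_mul]
  field_simp
  norm_num

theorem exists_fingerprint_measurement {X Y A B I QA QB : Type*} [Fintype A] [Fintype B]
    [Fintype I] [DecidableEq I] [Fintype QA] [DecidableEq QA] [Fintype QB] [DecidableEq QB]
    [DecidableEq A] [DecidableEq B] [Nonempty I] [Nonempty (A × B)] {eA : A → QA} {eB : B → QB}
    (hA : Function.Injective eA) (hB : Function.Injective eB) (f : I → X → A) (g : I → Y → B)
    (s : I → Bool) :
    ∃ π : ProductMeasurement X Y ((A × B) × Bool) (Bool × I × QA) (Bool × I × QB),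
      ∀ x y ab σ, π.law x y (ab, σ) = (1 + bitSign σ * (∑ i, bitSign (s i) *
        if (f i x, g i y) = ab then 1 else 0) / (2 * Fintype.card I)) /
          (2 * Fintype.card (A × B)) := by
  obtain ⟨i₀⟩ := ‹Nonempty I›
  obtain ⟨ab₀⟩ := ‹Nonempty (A × B)›
  have hI : (Fintype.card I : ℝ) ≠ 0 := by
    have : Nonempty I := ⟨i₀⟩
    exact_mod_cast Fintype.card_ne_zero
  have hN : (Fintype.card (A × B) : ℝ) ≠ 0 := by
    have : Nonempty (A × B) := ⟨ab₀⟩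
    exact_mod_cast Fintype.card_ne_zero
  set N : ℝ := (Fintype.card (A × B) : ℝ) with hNdef
  let dA : I × QA := (i₀, eA ab₀.1)
  let dB : I × QB := (i₀, eB ab₀.2)
  let vA : X → Bool × I × QA → ℝ := fun x => fingerprint dA (fun i => eA (f i x)) (fun _ => true)
  let vB : Y → Bool × I × QB → ℝ := fun y => fingerprint dB (fun i => eB (g i y)) s
  -- In `u` Bob's register carries the index `i`, in `w` Alice's does. Their cross term is nonzero
  -- only if `f i x = a` and `g i y = b` for the same `i`.
  let u : A × B → I → (Bool × I × QA) × (Bool × I × QB) :=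
    fun ab i => ((false, dA), (true, i, eB ab.2))
  let w : A × B → I → (Bool × I × QA) × (Bool × I × QB) :=
    fun ab i => ((true, i, eA ab.1), (false, dB))
  let π : ProductMeasurement X Y ((A × B) × Bool) (Bool × I × QA) (Bool × I × QB) :=
    { alice := fun x => realPure (vA x)
      alice_posSemidef := fun x => posSemidef_realPure _
      alice_trace := fun x => trace_realPure (sum_fingerprint_sq _ _ _)
      bob := fun y => realPure (vB y)
      bob_posSemidef := fun y => posSemidef_realPure _
      bob_trace := fun y => trace_realPure (sum_fingerprint_sq _ _ _)
      povm := fun o => (((2 * N)⁻¹ : ℝ) : ℂ) •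
        (1 + ((bitSign o.2 : ℝ) : ℂ) • exchange (u o.1) (w o.1))
      povm_posSemidef := fun o => by
        refine (posSemidef_one_add_smul_exchange ?_ ?_ ?_ ?_ ?_).smul
          (Complex.zero_le_real.2 (by positivity))
        · intro i j h; simpa [u] using h
        · intro i j h; simpa [w] using h
        · intro i j h; simp [u, w] at h
        · exact Complex.conj_ofReal _
        · rw [← Complex.ofReal_mul, ← sq, bitSign_sq, Complex.ofReal_one]
      povm_sum := by
        rw [Fintype.sum_prod_type]
        have h1 : ∀ ab : A × B, ∑ σ : Bool, (((2 * N)⁻¹ : ℝ) : ℂ) •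
            (1 + ((bitSign σ : ℝ) : ℂ) • exchange (u ab) (w ab)) =
            ((N⁻¹ : ℝ) : ℂ) • (1 : Matrix ((Bool × I × QA) × (Bool × I × QB)) _ ℂ) := by
          intro ab
          rw [Fintype.sum_bool, ← smul_add]
          simp only [bitSign, if_true, Bool.false_eq_true, if_false, Complex.ofReal_one, one_smul,
            Complex.ofReal_neg, neg_smul]
          rw [add_add_add_comm, add_neg_cancel, add_zero, ← two_smul ℂ, smul_smul]
          congr 1
          push_cast
          rw [mul_inv]
          ring
        rw [sum_congr rfl fun ab _ => h1 ab, sum_const, card_univ, ← Nat.cast_smul_eq_nsmul ℂ,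
          smul_smul]
        have h2 : ((Fintype.card (A × B) : ℕ) : ℂ) * ((N⁻¹ : ℝ) : ℂ) = 1 := by
          rw [← Complex.ofReal_natCast, ← Complex.ofReal_mul, ← hNdef, mul_inv_cancel₀ hN,
            Complex.ofReal_one]
        rw [h2, one_smul] }
  refine ⟨π, fun x y ab σ => ?_⟩
  set K := realPure (vA x) ⊗ₖ realPure (vB y) with hK
  have hKt : K.trace = 1 := by
    rw [hK, trace_kronecker, trace_realPure (sum_fingerprint_sq _ _ _),
      trace_realPure (sum_fingerprint_sq _ _ _), one_mul]
  -- The four amplitudes multiply to `± 1 / (4|I|)`. The two conjugate cross terms double this,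
  -- hence the denominator `2|I|` in the law. The sign comes from Bob's state alone.
  have hval : ∀ i, vA x (true, i, eA ab.1) * vA x (false, dA) *
      (vB y (false, dB) * vB y (true, i, eB ab.2)) =
      (bitSign (s i) * if (f i x, g i y) = ab then 1 else 0) * (4 * (Fintype.card I : ℝ))⁻¹ := by
    intro i
    have e1 : vA x (true, i, eA ab.1) =
        if f i x = ab.1 then (√(2 * Fintype.card I))⁻¹ else 0 := by
      simp [vA, fingerprint, hA.eq_iff, eq_comm, bitSign]
    have e2 : vB y (true, i, eB ab.2) =
        if g i y = ab.2 then bitSign (s i) * (√(2 * Fintype.card I))⁻¹ else 0 := by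
      simp [vB, fingerprint, hB.eq_iff, eq_comm]
    have e3 : vA x (false, dA) = (√2)⁻¹ := by simp [vA, fingerprint]
    have e4 : vB y (false, dB) = (√2)⁻¹ := by simp [vB, fingerprint]
    rw [e1, e2, e3, e4]
    simp only [Prod.ext_iff]
    by_cases h1 : f i x = ab.1 <;> by_cases h2 : g i y = ab.2 <;> simp only [h1, h2, if_true,
      if_false, and_self, and_true, and_false, zero_mul, mul_zero, mul_one]
    have h5 : (√(2 * Fintype.card I))⁻¹ * (√(2 * Fintype.card I))⁻¹ =
        (2 * (Fintype.card I : ℝ))⁻¹ := by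
      rw [← mul_inv, Real.mul_self_sqrt (by positivity)]
    have h6 : ((√2 : ℝ)⁻¹) * (√2)⁻¹ = 2⁻¹ := by
      rw [← mul_inv, Real.mul_self_sqrt (by norm_num)]
    calc _ = bitSign (s i) * ((√(2 * Fintype.card I))⁻¹ * (√(2 * Fintype.card I))⁻¹) *
          (((√2 : ℝ)⁻¹) * (√2)⁻¹) := by ring
      _ = _ := by rw [h5, h6, mul_inv, mul_inv]; ring
  have hex : (exchange (u ab) (w ab) * K).trace =
      (((∑ i, bitSign (s i) * if (f i x, g i y) = ab then 1 else 0) /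
        (2 * Fintype.card I) : ℝ) : ℂ) := by
    rw [exchange, Matrix.add_mul, trace_add, trace_basisColumns_mul, trace_basisColumns_mul,
      ← sum_add_distrib, Finset.sum_div]
    push_cast
    refine sum_congr rfl fun i _ => ?_
    have h1 : K (w ab i) (u ab i) + K (u ab i) (w ab i) =
        ((2 * (vA x (true, i, eA ab.1) * vA x (false, dA) *
      (vB y (false, dB) * vB y (true, i, eB ab.2))) : ℝ) : ℂ) := by
      simp only [hK, kroneckerMap_apply, realPure, of_apply, u, w]
      push_cast
      ring
    rw [h1, hval i]
    push_cast
    rw [mul_inv]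
    ring
  have hlaw : (π.povm (ab, σ) * K).trace = (((1 + bitSign σ * (∑ i, bitSign (s i) *
        if (f i x, g i y) = ab then 1 else 0) / (2 * Fintype.card I)) / (2 * N) : ℝ) : ℂ) := by
    simp only [π]
    rw [Matrix.smul_mul, trace_smul, Matrix.add_mul, Matrix.one_mul, trace_add, Matrix.smul_mul,
      trace_smul, hKt, hex]
    push_cast
    simp only [smul_eq_mul]
    ring
  exact congrArg Complex.re hlaw

end Fingerprint

/-! ### The quantum protocol -/

section Quantum

open Finset

variable {X Y A B : Type*} [Fintype X] [Fintype Y] [Fintype A] [Fintype B]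
  [DecidableEq X] [DecidableEq Y]

/-- A signed local model is uniformly approximated by a signed average of few local deterministic
distributions. -/
theorem exists_sparse_signed_model {c : (X → A) × (Y → B) → ℝ} (hL : 0 < ∑ fg, |c fg|) {τ : ℝ}
    (hτ : 0 < τ) (hτ1 : τ ≤ 1) {R : ℕ} (hR0 : 0 < R)
    (hR : Real.log (2 * Fintype.card ((X × Y) × A × B)) < R * τ ^ 2 / 4) :
    ∃ (f : Fin R → X → A) (g : Fin R → Y → B) (s : Fin R → Bool), ∀ x y ab,
      |(∑ fg, |c fg|) * ((∑ i, bitSign (s i) * localDeterministic (f i) (g i) x y ab) / R) -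
        (∑ fg, c fg • localDeterministic fg.1 fg.2 : Behavior X Y A B) x y ab| ≤
          (∑ fg, |c fg|) * τ := by
  obtain ⟨ω, hω⟩ := exists_sample_avg_near (abs_div_sum_mem_stdSimplex hL)
    (fun (j : (X × Y) × A × B) f =>
      bitSign (signBit (c f)) * localDeterministic f.1 f.2 j.1.1 j.1.2 j.2)
    (fun j f => by
      rw [abs_mul, abs_bitSign, one_mul, localDeterministic]
      split_ifs <;> simp) hτ hτ1 hR0 hR
  refine ⟨fun i => (ω i).1, fun i => (ω i).2, fun i => signBit (c (ω i)), fun x y ab => ?_⟩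
  have h := hω ((x, y), ab)
  have h1 : (∑ fg, c fg • localDeterministic fg.1 fg.2 : Behavior X Y A B) x y ab =
      (∑ fg, |c fg|) * ∑ f, |c f| / (∑ fg, |c fg|) *
        (bitSign (signBit (c f)) * localDeterministic f.1 f.2 x y ab) := by
    simp only [Finset.sum_apply, Pi.smul_apply, smul_eq_mul]
    rw [mul_sum]
    refine sum_congr rfl fun f _ => ?_
    rw [← mul_assoc, ← mul_assoc, mul_div_cancel₀ _ hL.ne', abs_mul_bitSign]
  rw [h1, ← mul_sub, abs_mul, abs_of_pos hL]
  exact mul_le_mul_of_nonneg_left h hL.le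

theorem exists_quantumProtocol [Nonempty X] [Nonempty Y] {p : Behavior X Y A B} (hp : IsNonSignaling p)
    {c : (X → A) × (Y → B) → ℝ} (hc : p = ∑ fg, c fg • localDeterministic fg.1 fg.2)
    {τ : ℝ} (hτ : 0 < τ) (hτ1 : τ ≤ 1) {ρ : ℕ}
    (hρ : Real.log (2 * Fintype.card ((X × Y) × A × B)) < (2 ^ ρ : ℕ) * τ ^ 2 / 4)
    {T : ℕ} {κ : ℝ} (hκ : 0 < κ)
    (hT : (2 * Fintype.card (A × B) * ∑ fg, |c fg|) ^ 2 ≤ T * κ ^ 2) :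
    ∃ π : QuantumProtocol X Y A B (T * (1 + (ρ + Nat.clog 2 (Fintype.card A))))
        (T * (1 + (ρ + Nat.clog 2 (Fintype.card B)))),
      ∀ x y (E : Finset (A × B)), |∑ ab ∈ E, p x y ab - ∑ ab ∈ E, π.output x y ab| ≤
        2 * Fintype.card (A × B) * ((∑ fg, |c fg|) * τ + κ) := by
  classical
  have hne : Nonempty (A × B) := hp.nonempty_output
  have : Nonempty A := hne.map Prod.fst
  have : Nonempty B := hne.map Prod.snd
  have hL0 : 0 < ∑ fg, |c fg| := lt_of_lt_of_le one_pos (one_le_sum_abs_of_signed_model hp hc)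
  have hN : (Fintype.card (A × B) : ℝ) ≠ 0 := by exact_mod_cast Fintype.card_ne_zero
  have hR : ((2 ^ ρ : ℕ) : ℝ) ≠ 0 := by positivity
  obtain ⟨f, g, s, hfgs⟩ := exists_sparse_signed_model hL0 hτ hτ1 (by positivity) hρ
  rw [← hc] at hfgs
  set L := ∑ fg, |c fg|
  set N : ℝ := (Fintype.card (A × B) : ℝ)
  obtain ⟨eA, dA, hA⟩ := exists_encoding_of_card_le (S := A) (Nat.le_pow_clog one_lt_two _)
  obtain ⟨eB, dB, hB⟩ := exists_encoding_of_card_le (S := B) (Nat.le_pow_clog one_lt_two _)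
  have : Nonempty (Fin (2 ^ ρ)) := ⟨⟨0, by positivity⟩⟩
  obtain ⟨M, hM⟩ := exists_fingerprint_measurement
    (Function.LeftInverse.injective hA) (Function.LeftInverse.injective hB) f g s
  -- The difference of the probabilities of `(ab, +)` and `(ab, -)` is the signed average divided by
  -- `2N`; the weight `2 N L` undoes this, leaving only the bias `L τ` of the sparse model.
  obtain ⟨W, hW, hWp⟩ := exists_postprocessing (O := (A × B) × Bool) (C := A × B)
    (fun o ab => if o.1 = ab then 2 * N * L * bitSign o.2 else 0) T
  obtain ⟨Q, hQ⟩ := M.exists_repetition (kA := 1 + (ρ + Nat.clog 2 (Fintype.card A)))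
    (kB := 1 + (ρ + Nat.clog 2 (Fintype.card B))) (by simp [pow_add]) (by simp [pow_add]) W hW
  refine ⟨Q, fun x y E => ?_⟩
  simp_rw [hQ x y]
  have hl := M.law_mem_stdSimplex x y
  refine hWp _ hl (p x y) (hp.isDistribution x y) (L * τ) ((2 * N * L) ^ 2) κ
    (fun ab => ?_) (fun ab => ?_) hκ hT E
  · refine le_of_eq_of_le ?_ (hfgs x y ab)
    congr 2
    rw [Fintype.sum_prod_type, sum_eq_single ab (fun ab' _ h => by simp [h]) (by simp)]
    simp only [if_true, Fintype.sum_bool, hM, Fintype.card_fin, bitSign, localDeterministic,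
      Bool.false_eq_true, if_false, eq_comm (a := ab)]
    field_simp
    ring
  · calc ∑ o, M.law x y o * (if o.1 = ab then 2 * N * L * bitSign o.2 else 0) ^ 2
        ≤ ∑ o, M.law x y o * (2 * N * L) ^ 2 := by
          refine sum_le_sum fun o _ => mul_le_mul_of_nonneg_left ?_ (hl.1 o)
          split_ifs
          · rw [mul_pow _ (bitSign _), bitSign_sq, mul_one]
          · rw [zero_pow two_ne_zero]
            positivity
      _ = (2 * N * L) ^ 2 := by rw [← sum_mul, hl.2, one_mul]

end Quantum

/-! ### Choice of parameters in the quantum bound -/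

section QuantumBound

open Finset

theorem logb_two_le_two_mul {x : ℝ} (hx : 0 < x) : Real.logb 2 x ≤ 2 * x := by
  have h2 := Real.log_two_gt_d9
  rw [Real.logb, div_le_iff₀ (by linarith)]
  have := Real.log_le_sub_one_of_pos hx
  nlinarith

theorem clog_ceil_le {n : ℕ} (hn : 2 ≤ n) {M : ℝ} (hM : 2 ≤ M) :
    (Nat.clog 2 ⌈64 * n * M ^ 3⌉₊ : ℝ) ≤ 8 + Real.logb 2 n + 6 * M := by
  have hn' : (2 : ℝ) ≤ n := by exact_mod_cast hn
  have hpos : 0 < 64 * (n : ℝ) * M ^ 3 := by positivity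
  refine (clog_le_logb_add_one (Nat.one_le_iff_ne_zero.2 (Nat.ceil_pos.2 hpos).ne')).trans ?_
  have h1 : (⌈64 * n * M ^ 3⌉₊ : ℝ) ≤ 128 * n * M ^ 3 := by
    have := (Nat.ceil_lt_add_one hpos.le).le
    have h8 : (2 : ℝ) ^ 3 ≤ M ^ 3 := by gcongr
    nlinarith
  have h2 : Real.logb 2 ⌈64 * n * M ^ 3⌉₊ ≤ Real.logb 2 (128 * n * M ^ 3) :=
    Real.logb_le_logb_of_le (by norm_num) (by exact_mod_cast Nat.ceil_pos.2 hpos) h1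
  have h3 : Real.logb 2 (128 * n * M ^ 3) = 7 + Real.logb 2 n + 3 * Real.logb 2 M := by
    rw [Real.logb_mul (by positivity) (by positivity), Real.logb_mul (by norm_num) (by positivity),
      Real.logb_pow, show (128 : ℝ) = 2 ^ 7 by norm_num, Real.logb_pow,
      Real.logb_self_eq_one (by norm_num)]
    norm_num
  have h4 := logb_two_le_two_mul (x := M) (by linarith)
  linarith

variable {X Y A B : Type*} [Fintype X] [Fintype Y] [Fintype A] [Fintype B]
  [DecidableEq X] [DecidableEq Y] [Nonempty X] [Nonempty Y]

theorem quantumComplexity_le {n : ℕ} (hn : 2 ≤ n) (hXY : Fintype.card (X × Y) ≤ 2 ^ n)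
    {p p' : Behavior X Y A B} (hp' : IsNonSignaling p') {ε δ : ℝ}
    (hd : tvDist p p' ≤ ε) (hδ : 0 < δ) (hδ2 : δ < 1 / 2)
    {c : (X → A) × (Y → B) → ℝ} (hc : p' = ∑ fg, c fg • localDeterministic fg.1 fg.2) :
    (quantumComplexity (ε + δ) p : ℝ) ≤
      4000 * (((Fintype.card A : ℝ) * (Fintype.card B : ℝ)) ^ 5
        * ((∑ fg, |c fg|) / δ) ^ 4
        * Real.log ((Fintype.card A : ℝ) * (Fintype.card B : ℝ) / δ)
        * Real.logb 2 (n : ℝ)) := by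
  have hne : Nonempty (A × B) := hp'.nonempty_output
  have : Nonempty A := hne.map Prod.fst
  have : Nonempty B := hne.map Prod.snd
  have hL1 : 1 ≤ ∑ fg, |c fg| := one_le_sum_abs_of_signed_model hp' hc
  have hA1 : 1 ≤ Fintype.card A := Fintype.card_pos
  have hB1 : 1 ≤ Fintype.card B := Fintype.card_pos
  have hcardAB : (Fintype.card (A × B) : ℝ) = (Fintype.card A : ℝ) * Fintype.card B := by
    rw [Fintype.card_prod, Nat.cast_mul]
  have hN : (1 : ℝ) ≤ (Fintype.card A : ℝ) * (Fintype.card B : ℝ) := by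
    exact_mod_cast Nat.one_le_iff_ne_zero.2 (mul_ne_zero (by omega) (by omega))
  set N := (Fintype.card A : ℝ) * (Fintype.card B : ℝ) with hNdef
  obtain ⟨L, hL⟩ : ∃ L, L = ∑ fg, |c fg| := ⟨_, rfl⟩
  rw [← hL] at hL1 ⊢
  have hn' : (2 : ℝ) ≤ n := by exact_mod_cast hn
  set M := N * L / δ with hM
  have hNM : 2 * N ≤ M := by
    rw [hM, le_div_iff₀ hδ]; nlinarith
  have hM2 : 2 ≤ M := by linarith
  set ρ := Nat.clog 2 ⌈64 * n * M ^ 3⌉₊ with hρdef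
  have hlogJ : Real.log (2 * Fintype.card ((X × Y) × A × B)) < (2 ^ ρ : ℕ) * (1 / (4 * M)) ^ 2 / 4 := by
    have h1 : (Fintype.card ((X × Y) × A × B) : ℝ) ≤ 2 ^ n * N := by
      rw [Fintype.card_prod, Nat.cast_mul, hcardAB]
      gcongr
      exact_mod_cast hXY
    have h0 : (0 : ℝ) < Fintype.card ((X × Y) × A × B) := by exact_mod_cast Fintype.card_pos
    have h2 : Real.log (2 * Fintype.card ((X × Y) × A × B)) ≤ n + N := by
      calc _ ≤ Real.log (2 ^ (n + 1) * N) := by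
            refine Real.log_le_log (by positivity) ?_
            rw [pow_succ]
            linarith
        _ = (n + 1) * Real.log 2 + Real.log N := by
            rw [Real.log_mul (by positivity) (by positivity), Real.log_pow]
            push_cast
            ring
        _ ≤ (n + 1) * 1 + (N - 1) := by
            have := Real.log_two_lt_d9
            gcongr
            · linarith
            · exact Real.log_le_sub_one_of_pos (by linarith)
        _ = _ := by ring
    -- With `τ = 1 / (4M)` this turns `2^ρ τ² / 4` into at least `n M`, which exceeds `n + N` since
    -- `M ≥ 2N` and `n ≥ 2`.
    have h3 : 64 * n * M ^ 3 ≤ ((2 ^ ρ : ℕ) : ℝ) :=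
      (Nat.le_ceil _).trans (Nat.cast_le.2 (Nat.le_pow_clog one_lt_two _))
    calc _ ≤ n + N := h2
      _ < n * M := by nlinarith
      _ = 64 * n * M ^ 3 * (1 / (4 * M)) ^ 2 / 4 := by field_simp; norm_num
      _ ≤ _ := by gcongr
  set T := ⌈64 * N ^ 2 * M ^ 2⌉₊
  have hT1 : 64 * N ^ 2 * M ^ 2 ≤ T := Nat.le_ceil _
  have hT2 : (T : ℝ) ≤ 64 * N ^ 2 * M ^ 2 + 1 := (Nat.ceil_lt_add_one (by positivity)).le
  -- Bias and fluctuation are balanced: `L τ = κ = δ / (4N)`, so the total error `2N (L τ + κ)` is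
  -- `δ`.
  obtain ⟨π, hπ⟩ := exists_quantumProtocol hp' hc (τ := 1 / (4 * M)) (by positivity)
    (by rw [div_le_one (by positivity)]; linarith) hlogJ (T := T) (κ := δ / (4 * N))
    (by positivity) (by
      rw [hcardAB, ← hL]
      calc (2 * N * L) ^ 2 = 64 * N ^ 2 * M ^ 2 * (δ / (4 * N)) ^ 2 := by
            rw [hM]; field_simp; norm_num
        _ ≤ _ := by gcongr)
  have hcost : quantumComplexity (ε + δ) p ≤ T * (1 + (ρ + Nat.clog 2 (Fintype.card A))) +
      T * (1 + (ρ + Nat.clog 2 (Fintype.card B))) := by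
    refine Nat.sInf_le ⟨_, _, π, tvDist_le_add hd fun x y E => (hπ x y E).trans (le_of_eq ?_), rfl⟩
    rw [hcardAB, ← hL, hM]
    field_simp
    norm_num
  have hcA := clog_le_logb_add_one hA1
  have hcB := clog_le_logb_add_one hB1
  have hlog : Real.logb 2 (Fintype.card A) + Real.logb 2 (Fintype.card B) = Real.logb 2 N := by
    rw [hNdef, Real.logb_mul (by positivity) (by positivity)]
  have hlogN := logb_two_le_two_mul (x := N) (by linarith)
  have hρ : (ρ : ℝ) ≤ 8 + Real.logb 2 n + 6 * M := clog_ceil_le hn hM2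
  have hl1 : 1 ≤ Real.logb 2 n := by
    rw [Real.le_logb_iff_rpow_le (by norm_num) (by linarith)]
    simpa using hn'
  have hln : 1 / 2 ≤ Real.log (N / δ) := by
    have h2 : (2 : ℝ) ≤ N / δ := by
      rw [le_div_iff₀ hδ]; linarith
    have := Real.log_two_gt_d9
    have := Real.log_le_log (by norm_num) h2
    linarith
  have hLδ : 1 ≤ L / δ := by
    rw [le_div_iff₀ hδ]; linarith
  set l := Real.logb 2 n
  have hbits : 2 + 2 * (ρ : ℝ) + Nat.clog 2 (Fintype.card A) + Nat.clog 2 (Fintype.card B) ≤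
      26 * M * l := by
    have h1 : M ≤ M * l := le_mul_of_one_le_right (by linarith) hl1
    have h2 : 2 * l ≤ M * l := by gcongr
    nlinarith
  calc (quantumComplexity (ε + δ) p : ℝ)
      ≤ T * (1 + (ρ + Nat.clog 2 (Fintype.card A))) +
        T * (1 + (ρ + Nat.clog 2 (Fintype.card B))) := by exact_mod_cast hcost
    _ = T * (2 + 2 * ρ + Nat.clog 2 (Fintype.card A) + Nat.clog 2 (Fintype.card B)) := by ring
    _ ≤ 65 * N ^ 2 * M ^ 2 * (26 * M * l) := by
        have h1 : (1 : ℝ) ≤ N ^ 2 * M ^ 2 :=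
          one_le_mul_of_one_le_of_one_le (one_le_pow₀ hN) (one_le_pow₀ (by linarith))
        gcongr
        linarith
    -- The crude estimate of `log₂ M` by `2 M` brings the cost to the third power of `L / δ`; as `L
    -- / δ ≥ 1`, this fits under the fourth.
    _ = 1690 * N ^ 5 * (L / δ) ^ 3 * l := by rw [hM]; field_simp; norm_num
    _ ≤ 2000 * N ^ 5 * (L / δ) ^ 4 * l := by
        gcongr
        · norm_num
        · norm_num
    _ = 4000 * (N ^ 5 * (L / δ) ^ 4 * (1 / 2) * l) := by ring
    _ ≤ 4000 * (N ^ 5 * (L / δ) ^ 4 * Real.log (N / δ) * l) := by gcongr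

end QuantumBound

end SMP

theorem mainTheorem6 :
    ∃ K : ℝ, 0 < K ∧
      ∀ (X Y A B : Type*) [Fintype X] [Fintype Y] [Fintype A] [Fintype B]
        [Nonempty X] [Nonempty Y] (n : ℕ), Fintype.card (X × Y) ≤ 2 ^ n →
      ∀ p : SMP.Behavior X Y A B, SMP.IsNonSignaling p →
      ∀ ε δ : ℝ, 0 ≤ ε → ε < 1 / 2 → 0 < δ → δ < 1 / 2 →
        (SMP.publicCoinComplexity (ε + δ) p : ℝ) ≤
            16 * ((Fintype.card A : ℝ) * (Fintype.card B : ℝ) * SMP.nuTildeApprox ε p / δ) ^ 2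
              * Real.log (4 * ((Fintype.card A : ℝ) * (Fintype.card B : ℝ)) / δ)
              * Real.logb 2 ((Fintype.card A : ℝ) * (Fintype.card B : ℝ)) ∧
        (2 ≤ n →
          (SMP.quantumComplexity (ε + δ) p : ℝ) ≤
            K * (((Fintype.card A : ℝ) * (Fintype.card B : ℝ)) ^ 5
              * (SMP.nuTildeApprox ε p / δ) ^ 4
              * Real.log ((Fintype.card A : ℝ) * (Fintype.card B : ℝ) / δ)
              * Real.logb 2 (n : ℝ))) := by
  refine ⟨4000, by norm_num, ?_⟩
  intro X Y A B _ _ _ _ _ _ n hXY p hp ε δ hε _ hδ hδ2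
  classical
  have hAB : Nonempty (A × B) := hp.nonempty_output
  have hcard : 1 ≤ Fintype.card A * Fintype.card B := by
    rw [← Fintype.card_prod]
    exact Fintype.card_pos
  have hN : (1 : ℝ) ≤ (Fintype.card A : ℝ) * (Fintype.card B : ℝ) := by exact_mod_cast hcard
  have hlogN : 0 ≤ Real.logb 2 ((Fintype.card A : ℝ) * (Fintype.card B : ℝ)) :=
    Real.logb_nonneg (by norm_num) hN
  have hlog1 : 0 ≤ Real.log (4 * ((Fintype.card A : ℝ) * (Fintype.card B : ℝ)) / δ) :=
    Real.log_nonneg (by rw [le_div_iff₀ hδ]; linarith)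
  have hlog2 : 0 ≤ Real.log ((Fintype.card A : ℝ) * (Fintype.card B : ℝ) / δ) :=
    Real.log_nonneg (by rw [le_div_iff₀ hδ]; linarith)
  -- A bound valid for the weight `s` of every signed model above the infimum passes to the infimum
  -- by continuity, so no minimizer is needed.
  have hcont : ∀ (F : ℝ → ℝ) (C : ℝ), Continuous F →
      (∀ s, SMP.nuTildeApprox ε p < s → C ≤ F s) → C ≤ F (SMP.nuTildeApprox ε p) := by
    intro F C hF h
    refine ge_of_tendsto (hF.continuousWithinAt (s := Set.Ioi (SMP.nuTildeApprox ε p))) ?_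
    filter_upwards [self_mem_nhdsWithin] with s hs using h s hs
  refine ⟨?_, fun hn => ?_⟩
  · rcases hcard.eq_or_lt with h1 | h2
    · rw [SMP.publicCoinComplexity_eq_zero hp (by linarith) (by rw [Fintype.card_prod, ← h1])]
      rw [Nat.cast_zero]
      positivity
    · refine hcont (fun s => 16 * ((Fintype.card A : ℝ) * (Fintype.card B : ℝ) * s / δ) ^ 2
        * Real.log (4 * ((Fintype.card A : ℝ) * (Fintype.card B : ℝ)) / δ)
        * Real.logb 2 ((Fintype.card A : ℝ) * (Fintype.card B : ℝ))) _ (by fun_prop) fun s hs => ?_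
      obtain ⟨p', hp', hd, c, hc, hcs⟩ := SMP.exists_approx_signed_model hp hε hs
      refine (SMP.publicCoinComplexity_le hp' hd hδ hδ2 hc h2).trans ?_
      gcongr
  · refine hcont (fun s => 4000 * (((Fintype.card A : ℝ) * (Fintype.card B : ℝ)) ^ 5
      * (s / δ) ^ 4 * Real.log ((Fintype.card A : ℝ) * (Fintype.card B : ℝ) / δ)
      * Real.logb 2 (n : ℝ))) _ (by fun_prop) fun s hs => ?_
    obtain ⟨p', hp', hd, c, hc, hcs⟩ := SMP.exists_approx_signed_model hp hε hs
    refine (SMP.quantumComplexity_le hn hXY hp' hd hδ hδ2 hc).trans ?_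
    have : 0 ≤ Real.logb 2 (n : ℝ) := Real.logb_nonneg (by norm_num) (by exact_mod_cast (by omega))
    gcongr
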